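/- **Definitions.** An MV-algebra $(A,\oplus,\neg,0)$ is a commutative monoid $(A,\oplus,0)$ with $\neg\neg x=x$, $x\oplus\neg 0=\neg 0$ and $\neg(\neg x\oplus y)\oplus y=\neg(\neg y\oplus x)\oplus x$; put $u=\neg 0$, $x\odot y=\neg(\neg x\oplus\neg y)$, $x\ominus y=x\odot\neg y$, and $x\le y$ iff $x\ominus y=0$ (a lattice order, with meet $\wedge$). A $PMV_f$-algebra is an MV-algebra with a commutative associative product such that $a0=0$, $a(b\oplus c)\le ab\oplus ac$, $ab\le a\wedge b$ and $a(b\ominus c)=ab\ominus ac$. A semi-low $l_u$-ring $(R,u)$ is a commutative ring (not necessarily with $1$) whose additive group is lattice-ordered, in which $x,y\ge 0$ implies $xy\ge 0$, with a strong unit $u\ge 0$ (for every $x$ there is $n\in\mathbb N$ with $|x|\le nu$) such that $ab\le a\wedge b$ for all $a,b\in[0,u]$. Let $\mathcal{PMV}_f$ be the category of $PMV_f$-algebras and maps preserving $0,\oplus,\neg,\cdot$, and $\mathcal{LR}_u$ the category of semi-low $l_u$-rings and maps preserving $+,\cdot,\vee,\wedge,u$. The functor $\Gamma:\mathcal{LR}_u\to\mathcal{PMV}_f$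 sends $(R,u)$ to $[0,u]=\{x\in R: 0\le x\le u\}$ with $x\oplus y=(x+y)\wedge u$, $\neg x=u-x$ and the product of $R$, and a homomorphism to its restriction. For a totally ordered $PMV_f$-algebra $C$, let $C^\sharp$ be $\mathbb Z\times C$ with $(m,u)$ and $(m+1,0)$ identified, with $(m,a)+(n,b)=(m+n,a\oplus b)$ if $a\oplus b\ne u$ and $(m+n+1,a\odot b)$ if $a\oplus b=u$; $-(m,a)=(-m-1,\neg a)$; the lexicographic order; and $(m,a)(n,b)=mn(0,u^2)+m(0,bu)+n(0,au)+(0,ab)$. A homomorphism $h$ of such chains induces $h^\sharp(m,a)=(m,h(a))$. An ideal of a $PMV_f$-algebra $A$ is a nonempty subset that is closed under $\oplus$ and downward closed; it is prime if $a\wedge b\in P$ implies $a\in P$ or $b\in P$. Then $A/P$, the quotient by the congruence $x\equiv y\iff(x\ominus y)\oplus(y\ominus x)\in P$, is totally ordered. Let $(0,\widehat a)\in\prod_P(A/P)^\sharp$ be the family $((0,[a]_P))_P$, where $P$ ranges over the prime ideals of $A$, and let $A^\sharp$ be the sub-$l$-ring (subring closed under $\vee,\wedge$) of $\prod_P(A/P)^\sharp$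 generated by $\{(0,\widehat a):a\in A\}$; it is a semi-low $l_u$-ring with strong unit $(0,\widehat u)$. For $h:A\to B$ in $\mathcal{PMV}_f$, $h^\sharp:A^\sharp\to B^\sharp$ is $h^\sharp(\sigma)(Q)=(h|_Q)^\sharp(\sigma(h^{-1}Q))$ with $h|_Q:A/h^{-1}Q\to B/Q$, $[a]\mapsto[h(a)]$; thus $h^\sharp\big(\sum_i\epsilon_i(0,\widehat{a_i})\big)=\sum_i\epsilon_i(0,\widehat{h(a_i)})$ for $\epsilon_i=\pm1$. **Theorem.** For every $PMV_f$-algebra $A$ the map $A\to\Gamma(A^\sharp,u)$, $a\mapsto(0,\widehat a)$, is an isomorphism of $PMV_f$-algebras, natural in $A$. For every semi-low $l_u$-ring $(R,u)$ there is an isomorphism of semi-low $l_u$-rings $\tau_R:\Gamma(R,u)^\sharp\to(R,u)$ with $\tau_R(0,\widehat x)=x$ for all $x\in[0,u]$, natural in $R$. Consequently $(-)^\sharp:\mathcal{PMV}_f\to\mathcal{LR}_u$ and $\Gamma:\mathcal{LR}_u\to\mathcal{PMV}_f$ form an equivalence of categories. -/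

import Mathlib

open CategoryTheory

set_option linter.unusedSectionVars false

universe v

namespace PMV

/-! ### MV-algebras -/

/-- MV-algebras `(A, ⊕, ¬, 0)`. -/
class MVAlgebra (A : Type*) extends Zero A where
  oplus : A → A → A
  mneg : A → A
  oplus_assoc : ∀ x y z : A, oplus (oplus x y) z = oplus x (oplus y z)
  oplus_comm : ∀ x y : A, oplus x y = oplus y x
  oplus_zero : ∀ x : A, oplus x 0 = x
  mneg_mneg : ∀ x : A, mneg (mneg x) = x
  oplus_top : ∀ x : A, oplus x (mneg 0) = mneg 0
  luk : ∀ x y : A, oplus (mneg (oplus (mneg x) y)) y = oplus (mneg (oplus (mneg y) x)) x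

infixl:65 " ⊕ₘ " => MVAlgebra.oplus
prefix:max "¬ₘ" => MVAlgebra.mneg

section MV

variable {A : Type*} [MVAlgebra A]

/-- The greatest element `u = ¬0`. -/
def mtop (A : Type*) [MVAlgebra A] : A := ¬ₘ(0 : A)

/-- `x ⊙ y = ¬(¬x ⊕ ¬y)`. -/
def odot (x y : A) : A := ¬ₘ(¬ₘx ⊕ₘ ¬ₘy)

/-- `x ⊖ y = x ⊙ ¬y = ¬(¬x ⊕ y)`. -/
def ominus (x y : A) : A := ¬ₘ(¬ₘx ⊕ₘ y)

infixl:70 " ⊙ₘ " => odot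
infixl:65 " ⊖ₘ " => ominus

theorem mneg_mneg (x : A) : ¬ₘ(¬ₘx) = x := MVAlgebra.mneg_mneg x
theorem oplus_comm (x y : A) : x ⊕ₘ y = y ⊕ₘ x := MVAlgebra.oplus_comm x y
theorem oplus_assoc (x y z : A) : x ⊕ₘ y ⊕ₘ z = x ⊕ₘ (y ⊕ₘ z) := MVAlgebra.oplus_assoc x y z
theorem oplus_left_comm (x y z : A) : x ⊕ₘ (y ⊕ₘ z) = y ⊕ₘ (x ⊕ₘ z) := by
  rw [← oplus_assoc, oplus_comm x y, oplus_assoc]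
theorem oplus_zero (x : A) : x ⊕ₘ 0 = x := MVAlgebra.oplus_zero x
theorem zero_oplus (x : A) : 0 ⊕ₘ x = x := by rw [oplus_comm, oplus_zero]
theorem oplus_mtop (x : A) : x ⊕ₘ mtop A = mtop A := MVAlgebra.oplus_top x
theorem mtop_oplus (x : A) : mtop A ⊕ₘ x = mtop A := by rw [oplus_comm, oplus_mtop]
theorem mneg_zero : ¬ₘ(0 : A) = mtop A := rfl
theorem mneg_mtop : ¬ₘ(mtop A) = 0 := mneg_mneg 0

theorem mneg_inj {x y : A} (h : ¬ₘx = ¬ₘy) : x = y := by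
  rw [← mneg_mneg x, h, mneg_mneg]

theorem oplus_mneg (x : A) : x ⊕ₘ ¬ₘx = mtop A := by
  have h := MVAlgebra.luk x (mtop A)
  rw [oplus_mtop, mneg_mtop, zero_oplus, oplus_comm] at h
  exact h.symm

theorem odot_mneg (x : A) : x ⊙ₘ ¬ₘx = 0 := by
  unfold odot; rw [oplus_mneg, mneg_mtop]

theorem odot_comm (x y : A) : x ⊙ₘ y = y ⊙ₘ x := by
  unfold odot; rw [oplus_comm]

theorem odot_assoc (x y z : A) : x ⊙ₘ y ⊙ₘ z = x ⊙ₘ (y ⊙ₘ z) := by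
  unfold odot; rw [mneg_mneg, mneg_mneg, oplus_assoc]

theorem mneg_odot (x y : A) : ¬ₘ(x ⊙ₘ y) = ¬ₘx ⊕ₘ ¬ₘy := mneg_mneg _

theorem mneg_oplus (x y : A) : ¬ₘ(x ⊕ₘ y) = ¬ₘx ⊙ₘ ¬ₘy := by
  unfold odot; rw [mneg_mneg, mneg_mneg]

theorem ominus_eq (x y : A) : x ⊖ₘ y = x ⊙ₘ ¬ₘy := by
  unfold odot ominus; rw [mneg_mneg]

/-- `x ≤ y` iff `x ⊖ y = 0`. -/
instance instLEMV : LE A := ⟨fun x y => x ⊖ₘ y = 0⟩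

theorem le_def {x y : A} : x ≤ y ↔ x ⊖ₘ y = 0 := Iff.rfl

theorem le_iff {x y : A} : x ≤ y ↔ ¬ₘx ⊕ₘ y = mtop A := by
  rw [le_def]; unfold ominus
  constructor
  · intro h; rw [← mneg_mneg (¬ₘx ⊕ₘ y), h, mneg_zero]
  · intro h; rw [h, mneg_mtop]

theorem sup_comm' (x y : A) : x ⊖ₘ y ⊕ₘ y = y ⊖ₘ x ⊕ₘ x := MVAlgebra.luk x y

theorem ominus_oplus_of_le {x y : A} (h : x ≤ y) : y ⊖ₘ x ⊕ₘ x = y := by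
  rw [sup_comm', le_def.1 h, zero_oplus]

theorem le_oplus_right (x z : A) : x ≤ x ⊕ₘ z := by
  rw [le_iff, ← oplus_assoc, oplus_comm (¬ₘx), oplus_mneg, mtop_oplus]

theorem le_oplus_left (x z : A) : x ≤ z ⊕ₘ x := by
  rw [oplus_comm]; exact le_oplus_right x z

theorem le_trans' {x y z : A} (h : x ≤ y) (h' : y ≤ z) : x ≤ z := by
  rw [← ominus_oplus_of_le h', ← ominus_oplus_of_le h, ← oplus_assoc]
  exact le_oplus_left _ _

theorem ominus_le_iff {x y z : A} : x ⊖ₘ y ≤ z ↔ x ≤ y ⊕ₘ z := by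
  rw [le_iff, le_iff]; unfold ominus; rw [mneg_mneg, oplus_assoc]

theorem mneg_le_mneg {x y : A} (h : x ≤ y) : ¬ₘy ≤ ¬ₘx := by
  rw [le_iff] at *; rw [mneg_mneg, oplus_comm, h]

theorem oplus_le_oplus_right' {x y : A} (h : x ≤ y) (z : A) : x ⊕ₘ z ≤ y ⊕ₘ z := by
  rw [← ominus_oplus_of_le h, oplus_assoc]; exact le_oplus_left _ _

theorem ominus_mono {x y : A} (h : x ≤ y) (z : A) : x ⊖ₘ z ≤ y ⊖ₘ z :=
  mneg_le_mneg (oplus_le_oplus_right' (mneg_le_mneg h) z)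

/-- The lattice of an MV-algebra: `x ∨ y = (x ⊖ y) ⊕ y` and `x ∧ y = ¬(¬x ∨ ¬y)`, with the order
`x ≤ y ↔ x ⊖ y = 0`. -/
instance instLatticeMV : Lattice A where
  le x y := x ≤ y
  le_refl x := by rw [le_iff, oplus_comm, oplus_mneg]
  le_trans _ _ _ := le_trans'
  le_antisymm x y h h' := by
    have := sup_comm' x y
    rwa [le_def.1 h, le_def.1 h', zero_oplus, zero_oplus, eq_comm] at this
  sup x y := x ⊖ₘ y ⊕ₘ y
  le_sup_left x y := by rw [sup_comm']; exact le_oplus_left _ _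
  le_sup_right x y := le_oplus_left _ _
  sup_le x y z hx hy := by
    have h := oplus_le_oplus_right' (ominus_mono hx y) y
    rwa [ominus_oplus_of_le hy] at h
  inf x y := ¬ₘ(¬ₘx ⊖ₘ ¬ₘy ⊕ₘ ¬ₘy)
  inf_le_left x y := by
    have : ¬ₘx ≤ ¬ₘx ⊖ₘ ¬ₘy ⊕ₘ ¬ₘy := by rw [sup_comm']; exact le_oplus_left _ _
    have := mneg_le_mneg this
    rwa [mneg_mneg x] at this
  inf_le_right x y := by
    have : ¬ₘy ≤ ¬ₘx ⊖ₘ ¬ₘy ⊕ₘ ¬ₘy := le_oplus_left _ _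
    have := mneg_le_mneg this
    rwa [mneg_mneg y] at this
  le_inf x y z hy hz := by
    have h := oplus_le_oplus_right' (ominus_mono (mneg_le_mneg hy) (¬ₘz)) (¬ₘz)
    rw [ominus_oplus_of_le (mneg_le_mneg hz)] at h
    have := mneg_le_mneg h
    rwa [mneg_mneg x] at this

theorem sup_def (x y : A) : x ⊔ y = x ⊖ₘ y ⊕ₘ y := rfl
theorem inf_def (x y : A) : x ⊓ y = ¬ₘ(¬ₘx ⊖ₘ ¬ₘy ⊕ₘ ¬ₘy) := rfl

theorem zero_le' (x : A) : 0 ≤ x := by rw [le_iff, mneg_zero, mtop_oplus]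
theorem le_mtop (x : A) : x ≤ mtop A := by rw [le_iff, oplus_mtop]
theorem le_zero_iff' {x : A} : x ≤ 0 ↔ x = 0 :=
  ⟨fun h => le_antisymm h (zero_le' x), fun h => h ▸ le_refl _⟩

theorem le_mneg_iff {x y : A} : x ≤ ¬ₘy ↔ x ⊙ₘ y = 0 := by
  rw [le_def, ominus_eq, mneg_mneg]

theorem mneg_le_iff {x y : A} : ¬ₘx ≤ y ↔ x ⊕ₘ y = mtop A := by
  rw [le_iff, mneg_mneg]

theorem oplus_mono {x x' y y' : A} (h : x ≤ x') (h' : y ≤ y') : x ⊕ₘ y ≤ x' ⊕ₘ y' := by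
  refine le_trans (oplus_le_oplus_right' h y) ?_
  rw [oplus_comm x' y, oplus_comm x' y']
  exact oplus_le_oplus_right' h' x'

theorem ominus_le_self (x y : A) : x ⊖ₘ y ≤ x := by
  rw [ominus_le_iff]; exact le_oplus_left _ _

theorem ominus_anti {y z : A} (x : A) (h : y ≤ z) : x ⊖ₘ z ≤ x ⊖ₘ y := by
  rw [ominus_le_iff]
  refine le_trans ?_ (oplus_mono h (le_refl _))
  rw [← ominus_le_iff]

theorem ominus_le_mneg (x y : A) : x ⊖ₘ y ≤ ¬ₘy :=
  mneg_le_mneg (le_oplus_left y (¬ₘx))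

theorem oplus_ominus (x d : A) : x ⊕ₘ d ⊖ₘ d = x ⊓ ¬ₘd := by
  rw [inf_def, mneg_mneg]; unfold ominus; rw [mneg_mneg]

theorem oplus_ominus_cancel {x d : A} (h : x ≤ ¬ₘd) : x ⊕ₘ d ⊖ₘ d = x := by
  rw [oplus_ominus]; exact inf_eq_left.2 h

theorem ominus_self (x : A) : x ⊖ₘ x = 0 := le_def.1 (le_refl x)

theorem ominus_inf_ominus (x y : A) : (x ⊖ₘ y) ⊓ (y ⊖ₘ x) = 0 := by
  set z := (x ⊖ₘ y) ⊓ (y ⊖ₘ x) with hz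
  set d := x ⊓ y with hd
  have h1 : z ≤ x ⊖ₘ d := le_trans inf_le_left (ominus_anti x inf_le_right)
  have h2 : z ≤ y ⊖ₘ d := le_trans inf_le_right (ominus_anti y inf_le_left)
  have e1 : z ⊕ₘ d ≤ x := by
    have := oplus_mono h1 (le_refl d); rwa [ominus_oplus_of_le inf_le_left] at this
  have e2 : z ⊕ₘ d ≤ y := by
    have := oplus_mono h2 (le_refl d); rwa [ominus_oplus_of_le inf_le_right] at this
  have e3 : z ⊕ₘ d ≤ d := le_inf e1 e2
  rw [← oplus_ominus_cancel (le_trans h1 (ominus_le_mneg x d))]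
  exact le_def.1 e3

theorem ominus_triangle (x y z : A) : x ⊖ₘ z ≤ (x ⊖ₘ y) ⊕ₘ (y ⊖ₘ z) := by
  rw [ominus_le_iff, oplus_left_comm]
  have h : y ≤ z ⊕ₘ (y ⊖ₘ z) := ominus_le_iff.1 (le_refl _)
  have h' : x ≤ (x ⊖ₘ y) ⊕ₘ y := by rw [oplus_comm]; exact ominus_le_iff.1 (le_refl _)
  exact le_trans h' (oplus_mono (le_refl _) h)

theorem oplus_ominus_oplus (x y x' y' : A) :
    (x ⊕ₘ x') ⊖ₘ (y ⊕ₘ y') ≤ (x ⊖ₘ y) ⊕ₘ (x' ⊖ₘ y') := by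
  rw [ominus_le_iff]
  have h : x ≤ y ⊕ₘ (x ⊖ₘ y) := ominus_le_iff.1 (le_refl _)
  have h' : x' ≤ y' ⊕ₘ (x' ⊖ₘ y') := ominus_le_iff.1 (le_refl _)
  refine le_trans (oplus_mono h h') (le_of_eq ?_)
  simp only [oplus_assoc, oplus_left_comm]

theorem mneg_ominus_mneg (x y : A) : ¬ₘx ⊖ₘ ¬ₘy = y ⊖ₘ x := by
  unfold ominus; rw [mneg_mneg, oplus_comm]

theorem odot_oplus_assoc {a b c : A} (h : a ⊙ₘ b = 0) (h' : b ⊕ₘ c = mtop A) :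
    (a ⊕ₘ b) ⊙ₘ c = a ⊕ₘ (b ⊙ₘ c) := by
  have hd : ¬ₘc ≤ b := by rw [mneg_le_iff, oplus_comm, h']
  have e1 : ∀ x : A, x ⊙ₘ c = x ⊖ₘ ¬ₘc := fun x => by rw [ominus_eq, mneg_mneg]
  rw [e1, e1]
  set d := ¬ₘc
  have hb : b = (b ⊖ₘ d) ⊕ₘ d := (ominus_oplus_of_le hd).symm
  set e := b ⊖ₘ d with he
  have hed : e ≤ ¬ₘd := ominus_le_mneg _ _
  have hle : a ⊕ₘ e ≤ ¬ₘd := by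
    have h1 : a ≤ ¬ₘd ⊖ₘ e := by
      rw [← le_mneg_iff, hb, mneg_oplus, odot_comm] at h
      rw [ominus_eq]; exact h
    have := oplus_mono h1 (le_refl e)
    rwa [ominus_oplus_of_le hed] at this
  rw [hb, ← oplus_assoc, oplus_ominus_cancel hle]

theorem oplus_odot_assoc {a b c : A} (h : a ⊙ₘ b = 0) (h' : b ⊙ₘ c = 0) :
    (a ⊕ₘ b) ⊙ₘ c = a ⊙ₘ (b ⊕ₘ c) := by
  have hd : b ≤ ¬ₘc := le_mneg_iff.2 h'
  have ha : a ≤ ¬ₘb := le_mneg_iff.2 h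
  have e1 : (a ⊕ₘ b) ⊙ₘ c = (a ⊕ₘ b) ⊖ₘ ¬ₘc := by rw [ominus_eq, mneg_mneg]
  have e2 : a ⊙ₘ (b ⊕ₘ c) = a ⊖ₘ (¬ₘc ⊖ₘ b) := by
    rw [ominus_eq]; unfold ominus; rw [mneg_mneg, mneg_mneg, oplus_comm b c]
  rw [e1, e2]
  set d := ¬ₘc
  have hdb : (d ⊖ₘ b) ⊕ₘ b = d := ominus_oplus_of_le hd
  apply le_antisymm
  · rw [ominus_le_iff]
    have h1 : a ≤ (d ⊖ₘ b) ⊕ₘ (a ⊖ₘ (d ⊖ₘ b)) := ominus_le_iff.1 (le_refl _)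
    refine le_trans (oplus_mono h1 (le_refl b)) (le_of_eq ?_)
    generalize a ⊖ₘ (d ⊖ₘ b) = z
    conv_rhs => rw [← hdb]
    rw [oplus_assoc, oplus_assoc, oplus_comm b]
  · rw [ominus_le_iff]
    have h1 : a ⊕ₘ b ≤ d ⊕ₘ ((a ⊕ₘ b) ⊖ₘ d) := ominus_le_iff.1 (le_refl _)
    have h2 := ominus_mono h1 b
    rw [oplus_ominus_cancel ha] at h2
    refine le_trans h2 ?_
    rw [ominus_le_iff, ← oplus_assoc, oplus_comm b, hdb]

theorem odot_oplus_assoc' {a b c : A} (h : a ⊕ₘ b = mtop A) (h' : b ⊕ₘ c = mtop A) :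
    (a ⊙ₘ b) ⊕ₘ c = a ⊕ₘ (b ⊙ₘ c) := by
  apply mneg_inj
  rw [mneg_oplus, mneg_odot, mneg_oplus, mneg_odot]
  apply oplus_odot_assoc
  · rw [← mneg_oplus, h, mneg_mtop]
  · rw [← mneg_oplus, h', mneg_mtop]

/-- Ideals of an MV-algebra. -/
structure MVIdeal (A : Type*) [MVAlgebra A] where
  carrier : Set A
  nonempty' : carrier.Nonempty
  mem_of_le : ∀ {a b : A}, a ≤ b → b ∈ carrier → a ∈ carrier
  oplus_mem : ∀ {a b : A}, a ∈ carrier → b ∈ carrier → a ⊕ₘ b ∈ carrier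

theorem MVIdeal.zero_mem (I : MVIdeal A) : (0 : A) ∈ I.carrier := by
  obtain ⟨x, hx⟩ := I.nonempty'
  exact I.mem_of_le (zero_le' x) hx

/-- The set of prime ideals of an MV-algebra. (The improper ideal satisfies the condition as well;
its quotient is the one-element algebra.) -/
def Spec (A : Type*) [MVAlgebra A] : Type _ :=
  {P : MVIdeal A // ∀ a b : A, a ⊓ b ∈ P.carrier → a ∈ P.carrier ∨ b ∈ P.carrier}

/-- MV-chains. -/
class MVChain (A : Type*) [MVAlgebra A] : Prop where
  total : ∀ a b : A, a ≤ b ∨ b ≤ a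

end MV

/-! ### `PMV_f`-algebras -/

/-- `PMV_f`-algebras: MV-algebras with a commutative associative product satisfying the axioms of
an MVW-rig, `ab ≤ a ∧ b` and `a(b ⊖ c) = ab ⊖ ac`. -/
class PMVfAlgebra (A : Type*) extends MVAlgebra A, Mul A where
  mul_assoc : ∀ a b c : A, a * b * c = a * (b * c)
  mul_comm : ∀ a b : A, a * b = b * a
  mul_zero : ∀ a : A, a * 0 = 0
  mul_oplus_le : ∀ a b c : A, a * (b ⊕ₘ c) ≤ a * b ⊕ₘ a * c
  le_mul_ominus : ∀ a b c : A, a * b ⊖ₘ a * c ≤ a * (b ⊖ₘ c)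
  mul_le_inf : ∀ a b : A, a * b ≤ a ⊓ b
  mul_ominus : ∀ a b c : A, a * (b ⊖ₘ c) = a * b ⊖ₘ a * c

/-- Homomorphisms of `PMV_f`-algebras. -/
@[ext]
structure PMVfHom (A B : Type*) [PMVfAlgebra A] [PMVfAlgebra B] where
  toFun : A → B
  map_zero' : toFun 0 = 0
  map_oplus' : ∀ x y, toFun (x ⊕ₘ y) = toFun x ⊕ₘ toFun y
  map_mneg' : ∀ x, toFun (¬ₘx) = ¬ₘ(toFun x)
  map_mul' : ∀ x y, toFun (x * y) = toFun x * toFun y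

section PMVf

variable {A B C : Type*} [PMVfAlgebra A] [PMVfAlgebra B] [PMVfAlgebra C]

instance : FunLike (PMVfHom A B) A B where
  coe f := f.toFun
  coe_injective f g h := by ext x; exact congrFun h x

/-- The identity homomorphism. -/
def PMVfHom.id (A : Type*) [PMVfAlgebra A] : PMVfHom A A :=
  ⟨fun x => x, rfl, fun _ _ => rfl, fun _ => rfl, fun _ _ => rfl⟩

/-- Composition of homomorphisms. -/
def PMVfHom.comp (g : PMVfHom B C) (f : PMVfHom A B) : PMVfHom A C where
  toFun x := g (f x)
  map_zero' := by
    change g.toFun (f.toFun 0) = 0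
    rw [f.map_zero', g.map_zero']
  map_oplus' x y := by
    change g.toFun (f.toFun _) = g.toFun (f.toFun x) ⊕ₘ g.toFun (f.toFun y)
    rw [f.map_oplus', g.map_oplus']
  map_mneg' x := by
    change g.toFun (f.toFun _) = ¬ₘ(g.toFun (f.toFun x))
    rw [f.map_mneg', g.map_mneg']
  map_mul' x y := by
    change g.toFun (f.toFun _) = g.toFun (f.toFun x) * g.toFun (f.toFun y)
    rw [f.map_mul', g.map_mul']

theorem PMVfHom.map_zero (f : PMVfHom A B) : f 0 = 0 := f.map_zero'
theorem PMVfHom.map_oplus (f : PMVfHom A B) (x y : A) : f (x ⊕ₘ y) = f x ⊕ₘ f y := f.map_oplus' x y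
theorem PMVfHom.map_mneg (f : PMVfHom A B) (x : A) : f (¬ₘx) = ¬ₘ(f x) := f.map_mneg' x
theorem PMVfHom.map_mul (f : PMVfHom A B) (x y : A) : f (x * y) = f x * f y := f.map_mul' x y
theorem PMVfHom.map_mtop (f : PMVfHom A B) : f (mtop A) = mtop B := by
  unfold mtop; rw [f.map_mneg, f.map_zero]
theorem PMVfHom.map_odot (f : PMVfHom A B) (x y : A) : f (x ⊙ₘ y) = f x ⊙ₘ f y := by
  unfold odot; simp only [f.map_mneg, f.map_oplus]
theorem PMVfHom.map_ominus (f : PMVfHom A B) (x y : A) : f (x ⊖ₘ y) = f x ⊖ₘ f y := by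
  unfold ominus; simp only [f.map_mneg, f.map_oplus]
theorem PMVfHom.map_inf (f : PMVfHom A B) (x y : A) : f (x ⊓ y) = f x ⊓ f y := by
  simp only [inf_def, f.map_mneg, f.map_oplus, f.map_ominus]
theorem PMVfHom.mono (f : PMVfHom A B) {x y : A} (h : x ≤ y) : f x ≤ f y := by
  rw [le_def] at *; rw [← f.map_ominus, h, f.map_zero]

theorem pmul_comm (a b : A) : a * b = b * a := PMVfAlgebra.mul_comm a b
theorem pmul_assoc (a b c : A) : a * b * c = a * (b * c) := PMVfAlgebra.mul_assoc a b c
theorem pmul_zero (a : A) : a * 0 = 0 := PMVfAlgebra.mul_zero a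
theorem pzero_mul (a : A) : 0 * a = 0 := by rw [pmul_comm, pmul_zero]
theorem pmul_ominus (a b c : A) : a * (b ⊖ₘ c) = a * b ⊖ₘ a * c := PMVfAlgebra.mul_ominus a b c
theorem pmul_le_left (a b : A) : a * b ≤ a := le_trans (PMVfAlgebra.mul_le_inf a b) inf_le_left
theorem pmul_le_right (a b : A) : a * b ≤ b := le_trans (PMVfAlgebra.mul_le_inf a b) inf_le_right

theorem pmul_mono {b c : A} (a : A) (h : b ≤ c) : a * b ≤ a * c := by
  rw [le_def, ← pmul_ominus, le_def.1 h, pmul_zero]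

theorem pmul_odot {a b : A} (h : a ⊙ₘ b = 0) (c : A) : (c * a) ⊙ₘ (c * b) = 0 := by
  rw [← le_mneg_iff] at *
  exact le_trans (pmul_le_right c a) (le_trans h (mneg_le_mneg (pmul_le_right c b)))

theorem pmul_oplus {a b : A} (h : a ⊙ₘ b = 0) (c : A) : c * (a ⊕ₘ b) = c * a ⊕ₘ c * b := by
  have h1 : c * a = c * (a ⊕ₘ b) ⊖ₘ c * b := by
    rw [← pmul_ominus, oplus_ominus_cancel (le_mneg_iff.2 h)]
  rw [h1, ominus_oplus_of_le (pmul_mono c (le_oplus_left b a))]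

/-! ### Quotients by ideals -/

/-- The congruence `x ≡ y ↔ (x ⊖ y) ⊕ (y ⊖ x) ∈ I`. -/
def MVIdeal.rel {A : Type*} [MVAlgebra A] (I : MVIdeal A) (x y : A) : Prop :=
  (x ⊖ₘ y) ⊕ₘ (y ⊖ₘ x) ∈ I.carrier

theorem MVIdeal.rel_iff {A : Type*} [MVAlgebra A] (I : MVIdeal A) {x y : A} :
    I.rel x y ↔ x ⊖ₘ y ∈ I.carrier ∧ y ⊖ₘ x ∈ I.carrier :=
  ⟨fun h => ⟨I.mem_of_le (le_oplus_right _ _) h, I.mem_of_le (le_oplus_left _ _) h⟩,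
    fun h => I.oplus_mem h.1 h.2⟩

/-- The setoid of `I.rel`. -/
def MVIdeal.setoid {A : Type*} [MVAlgebra A] (I : MVIdeal A) : Setoid A where
  r := I.rel
  iseqv :=
    { refl := fun x => by
        rw [I.rel_iff, ominus_self]; exact ⟨I.zero_mem, I.zero_mem⟩
      symm := fun h => by
        rw [I.rel_iff] at *; exact ⟨h.2, h.1⟩
      trans := fun {x y z} h h' => by
        rw [I.rel_iff] at *
        exact ⟨I.mem_of_le (ominus_triangle x y z) (I.oplus_mem h.1 h'.1),
          I.mem_of_le (ominus_triangle z y x) (I.oplus_mem h'.2 h.2)⟩ }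

/-- The quotient `A/I`. -/
def MVIdeal.Quo {A : Type*} [MVAlgebra A] (I : MVIdeal A) : Type _ := Quotient I.setoid

/-- The class `[a]_I`. -/
def MVIdeal.cls {A : Type*} [MVAlgebra A] (I : MVIdeal A) (a : A) : I.Quo := Quotient.mk I.setoid a

theorem MVIdeal.cls_eq {A : Type*} [MVAlgebra A] (I : MVIdeal A) {a b : A} :
    I.cls a = I.cls b ↔ a ⊖ₘ b ∈ I.carrier ∧ b ⊖ₘ a ∈ I.carrier := by
  rw [← I.rel_iff]; exact Quotient.eq (r := I.setoid)

theorem MVIdeal.cls_surj {A : Type*} [MVAlgebra A] (I : MVIdeal A) (x : I.Quo) :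
    ∃ a, I.cls a = x := Quotient.exists_rep x

theorem mul_ominus_mul_le (x y x' y' : A) :
    (x * x') ⊖ₘ (y * y') ≤ (x ⊖ₘ y) ⊕ₘ (x' ⊖ₘ y') := by
  refine le_trans (ominus_triangle _ (y * x') _) (oplus_mono ?_ ?_)
  · rw [pmul_comm x, pmul_comm y, ← pmul_ominus]; exact pmul_le_right _ _
  · rw [← pmul_ominus]; exact pmul_le_right _ _

/-- `A/I` with `[a] ⊕ [b] = [a ⊕ b]`, `¬[a] = [¬a]`, `[a][b] = [ab]`. -/
instance instPMVfQuo (I : MVIdeal A) : PMVfAlgebra I.Quo where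
  zero := I.cls 0
  oplus := Quotient.map₂ (sa := I.setoid) (sb := I.setoid) (sc := I.setoid) (fun a b => a ⊕ₘ b)
    (by
      intro a a' h b b' h'
      have h := I.rel_iff.1 h
      have h' := I.rel_iff.1 h'
      exact I.rel_iff.2 ⟨I.mem_of_le (oplus_ominus_oplus _ _ _ _) (I.oplus_mem h.1 h'.1),
        I.mem_of_le (oplus_ominus_oplus _ _ _ _) (I.oplus_mem h.2 h'.2)⟩)
  mneg := Quotient.map (sa := I.setoid) (sb := I.setoid) (fun a => ¬ₘa)
    (by
      intro a a' h
      have h := I.rel_iff.1 h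
      exact I.rel_iff.2 (by rw [mneg_ominus_mneg, mneg_ominus_mneg]; exact ⟨h.2, h.1⟩))
  mul := Quotient.map₂ (sa := I.setoid) (sb := I.setoid) (sc := I.setoid) (fun a b => a * b)
    (by
      intro a a' h b b' h'
      have h := I.rel_iff.1 h
      have h' := I.rel_iff.1 h'
      exact I.rel_iff.2 ⟨I.mem_of_le (mul_ominus_mul_le _ _ _ _) (I.oplus_mem h.1 h'.1),
        I.mem_of_le (mul_ominus_mul_le _ _ _ _) (I.oplus_mem h.2 h'.2)⟩)
  oplus_assoc := by
    rintro ⟨x⟩ ⟨y⟩ ⟨z⟩; exact congrArg I.cls (oplus_assoc x y z)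
  oplus_comm := by
    rintro ⟨x⟩ ⟨y⟩; exact congrArg I.cls (oplus_comm x y)
  oplus_zero := by
    rintro ⟨x⟩; exact congrArg I.cls (oplus_zero x)
  mneg_mneg := by
    rintro ⟨x⟩; exact congrArg I.cls (mneg_mneg x)
  oplus_top := by
    rintro ⟨x⟩; exact congrArg I.cls (oplus_mtop x)
  luk := by
    rintro ⟨x⟩ ⟨y⟩; exact congrArg I.cls (MVAlgebra.luk x y)
  mul_assoc := by
    rintro ⟨x⟩ ⟨y⟩ ⟨z⟩; exact congrArg I.cls (pmul_assoc x y z)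
  mul_comm := by
    rintro ⟨x⟩ ⟨y⟩; exact congrArg I.cls (pmul_comm x y)
  mul_zero := by
    rintro ⟨x⟩; exact congrArg I.cls (pmul_zero x)
  mul_oplus_le := by
    rintro ⟨x⟩ ⟨y⟩ ⟨z⟩; exact congrArg I.cls (le_def.1 (PMVfAlgebra.mul_oplus_le x y z))
  le_mul_ominus := by
    rintro ⟨x⟩ ⟨y⟩ ⟨z⟩; exact congrArg I.cls (le_def.1 (PMVfAlgebra.le_mul_ominus x y z))
  mul_le_inf := by
    rintro ⟨x⟩ ⟨y⟩; exact congrArg I.cls (le_def.1 (PMVfAlgebra.mul_le_inf x y))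
  mul_ominus := by
    rintro ⟨x⟩ ⟨y⟩ ⟨z⟩; exact congrArg I.cls (pmul_ominus x y z)

/-- The projection `A → A/I`. -/
def MVIdeal.proj (I : MVIdeal A) : PMVfHom A I.Quo where
  toFun := I.cls
  map_zero' := rfl
  map_oplus' _ _ := rfl
  map_mneg' _ := rfl
  map_mul' _ _ := rfl

theorem MVIdeal.cls_le (I : MVIdeal A) {a b : A} : I.cls a ≤ I.cls b ↔ a ⊖ₘ b ∈ I.carrier := by
  have : I.cls a ≤ I.cls b ↔ I.cls (a ⊖ₘ b) = I.cls 0 := Iff.rfl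
  rw [this, I.cls_eq]
  have e : (a ⊖ₘ b) ⊖ₘ 0 = a ⊖ₘ b := by
    unfold ominus; rw [oplus_zero, mneg_mneg]
  rw [e, le_def.1 (zero_le' (a ⊖ₘ b))]
  exact ⟨fun h => h.1, fun h => ⟨h, I.zero_mem⟩⟩

/-- The quotient by a prime ideal is a chain. -/
instance instMVChainQuo (P : Spec A) : MVChain P.1.Quo where
  total := by
    intro x y
    obtain ⟨a, rfl⟩ := P.1.cls_surj x
    obtain ⟨b, rfl⟩ := P.1.cls_surj y
    rw [P.1.cls_le, P.1.cls_le]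
    apply P.2
    rw [ominus_inf_ominus]; exact P.1.zero_mem

/-- The inverse image of a prime ideal. -/
def Spec.comap (h : PMVfHom A B) (Q : Spec B) : Spec A :=
  ⟨{ carrier := h ⁻¹' Q.1.carrier
     nonempty' := ⟨0, by
      change h 0 ∈ Q.1.carrier
      rw [h.map_zero]; exact Q.1.zero_mem⟩
     mem_of_le := fun hab hb => Q.1.mem_of_le (h.mono hab) hb
     oplus_mem := fun {a b} ha hb => by
      change h (a ⊕ₘ b) ∈ Q.1.carrier
      rw [h.map_oplus]; exact Q.1.oplus_mem ha hb },
    fun a b hab => by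
      apply Q.2 (h a) (h b)
      rw [← h.map_inf]; exact hab⟩

/-- `h|_Q : A/h⁻¹Q → B/Q`, `[a] ↦ [h a]`. -/
def PMVfHom.restr (h : PMVfHom A B) (Q : Spec B) : PMVfHom (Spec.comap h Q).1.Quo Q.1.Quo where
  toFun := Quotient.lift (s := (Spec.comap h Q).1.setoid) (fun a => Q.1.cls (h a)) (by
    intro a b hab
    have hab := (Spec.comap h Q).1.rel_iff.1 hab
    rw [Q.1.cls_eq, ← h.map_ominus, ← h.map_ominus]
    exact hab)
  map_zero' := congrArg Q.1.cls h.map_zero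
  map_oplus' := by
    rintro ⟨x⟩ ⟨y⟩; exact congrArg Q.1.cls (h.map_oplus x y)
  map_mneg' := by
    rintro ⟨x⟩; exact congrArg Q.1.cls (h.map_mneg x)
  map_mul' := by
    rintro ⟨x⟩ ⟨y⟩; exact congrArg Q.1.cls (h.map_mul x y)

theorem PMVfHom.restr_cls (h : PMVfHom A B) (Q : Spec B) (a : A) :
    h.restr Q ((Spec.comap h Q).1.cls a) = Q.1.cls (h a) := rfl

end PMVf

/-! ### Chang's construction for chains -/

section Chang

variable {A : Type*}

/-- The identification `(m, u) = (m + 1, 0)` on `ℤ × A`. -/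
inductive ChangRel (A : Type*) [MVAlgebra A] : ℤ × A → ℤ × A → Prop
  | glue (m : ℤ) : ChangRel A (m, mtop A) (m + 1, 0)

/-- The underlying set `|A^*|`: pairs `(m, a)` with `(m, u)` and `(m + 1, 0)` identified. -/
def Chang (A : Type*) [MVAlgebra A] : Type _ := Quot (ChangRel A)

namespace Chang

section Group

variable [MVAlgebra A]

/-- The class of `(m, a)`. -/
def pair (m : ℤ) (a : A) : Chang A := Quot.mk _ (m, a)

theorem glue (m : ℤ) : pair m (mtop A) = pair (m + 1) (0 : A) := Quot.sound (ChangRel.glue m)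

theorem exists_pair (x : Chang A) : ∃ m a, x = pair m a := by
  induction x using Quot.ind with
  | mk p => exact ⟨p.1, p.2, rfl⟩

open Classical in
/-- `(m, a) + (n, b)`, before passing to classes. -/
noncomputable def addPair (p q : ℤ × A) : Chang A :=
  if p.2 ⊕ₘ q.2 = mtop A then pair (p.1 + q.1 + 1) (p.2 ⊙ₘ q.2) else pair (p.1 + q.1) (p.2 ⊕ₘ q.2)

theorem addPair_comm (p q : ℤ × A) : addPair p q = addPair q p := by
  unfold addPair; rw [oplus_comm, odot_comm, add_comm p.1]

theorem mtop_odot (b : A) : mtop A ⊙ₘ b = b := by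
  unfold odot; rw [mneg_mtop, zero_oplus, mneg_mneg]

theorem zero_odot (b : A) : (0 : A) ⊙ₘ b = 0 := by
  unfold odot; rw [mneg_zero, mtop_oplus, mneg_mtop]

theorem addPair_glue (m : ℤ) (q : ℤ × A) : addPair (m, mtop A) q = addPair (m + 1, 0) q := by
  unfold addPair
  simp only [mtop_oplus, zero_oplus, mtop_odot, zero_odot, if_true]
  split_ifs with h
  · rw [zero_oplus] at h
    rw [h, glue]; congr 1; ring
  · congr 1; ring

/-- Addition: `(m, a) + (n, b)` is `(m + n, a ⊕ b)` if `a ⊕ b ≠ u` and `(m + n + 1, a ⊙ b)` if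
`a ⊕ b = u`. -/
noncomputable instance : Add (Chang A) where
  add := Quot.lift₂ addPair
    (by rintro p _ _ ⟨m⟩; rw [addPair_comm, addPair_glue, addPair_comm])
    (by rintro _ _ q ⟨m⟩; rw [addPair_glue])

instance : Zero (Chang A) := ⟨pair 0 0⟩

/-- Opposite: `-(m, a) = (-m - 1, ¬a)`. -/
instance : Neg (Chang A) where
  neg := Quot.lift (fun p => pair (-p.1 - 1) (¬ₘp.2)) (by
    rintro _ _ ⟨m⟩
    change pair (-m - 1) (¬ₘ(mtop A)) = pair (-(m + 1) - 1) (¬ₘ(0 : A))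
    rw [mneg_mtop, mneg_zero, glue]; congr 1; ring)

theorem zero_def : (0 : Chang A) = pair 0 0 := rfl
theorem neg_pair (m : ℤ) (a : A) : -pair m a = pair (-m - 1) (¬ₘa) := rfl
theorem pair_add (m n : ℤ) (a b : A) : pair m a + pair n b = addPair (m, a) (n, b) := rfl

theorem pair_add_of_eq (m n : ℤ) {a b : A} (h : a ⊕ₘ b = mtop A) :
    pair m a + pair n b = pair (m + n + 1) (a ⊙ₘ b) := by
  rw [pair_add]; exact if_pos h

variable [MVChain A]

theorem odot_or (a b : A) : a ⊙ₘ b = 0 ∨ a ⊕ₘ b = mtop A := by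
  rcases MVChain.total a (¬ₘb) with h | h
  · exact Or.inl (le_mneg_iff.1 h)
  · right; rw [oplus_comm]; exact mneg_le_iff.1 h

theorem pair_add_of_odot {A : Type*} [MVAlgebra A] (m n : ℤ) {a b : A} (h : a ⊙ₘ b = 0) :
    pair m a + pair n b = pair (m + n) (a ⊕ₘ b) := by
  rw [pair_add]; unfold addPair
  split_ifs with h'
  · change pair (m + n + 1) (a ⊙ₘ b) = _
    change a ⊕ₘ b = _ at h'
    rw [h, h', glue]
  · rfl

theorem add_comm' (x y : Chang A) : x + y = y + x := by
  obtain ⟨m, a, rfl⟩ := exists_pair x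
  obtain ⟨n, b, rfl⟩ := exists_pair y
  exact addPair_comm _ _

theorem assoc_aux (m n k : ℤ) {a b c : A} (h : a ⊙ₘ b = 0) (h' : b ⊕ₘ c = mtop A) :
    pair m a + pair n b + pair k c = pair m a + (pair n b + pair k c) := by
  rw [pair_add_of_odot _ _ h, pair_add_of_eq _ _ h',
    pair_add_of_eq _ _ (by rw [oplus_assoc, h', oplus_mtop]),
    pair_add_of_odot _ _ (by rw [← odot_assoc, h, zero_odot]), odot_oplus_assoc h h']
  congr 1; ring

theorem add_assoc' (x y z : Chang A) : x + y + z = x + (y + z) := by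
  obtain ⟨m, a, rfl⟩ := exists_pair x
  obtain ⟨n, b, rfl⟩ := exists_pair y
  obtain ⟨k, c, rfl⟩ := exists_pair z
  rcases odot_or a b with h | h <;> rcases odot_or b c with h' | h'
  · rw [pair_add_of_odot _ _ h, pair_add_of_odot _ _ h']
    rcases odot_or (a ⊕ₘ b) c with e | e
    · rw [pair_add_of_odot _ _ e, pair_add_of_odot _ _ (by rw [← oplus_odot_assoc h h', e]),
        oplus_assoc, add_assoc]
    · rw [pair_add_of_eq _ _ e, pair_add_of_eq _ _ (by rw [← oplus_assoc, e]),
        oplus_odot_assoc h h', add_assoc m]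
  · exact assoc_aux m n k h h'
  · have := assoc_aux k n m (a := c) (b := b) (c := a) (by rw [odot_comm, h'])
      (by rw [oplus_comm, h])
    rw [add_comm' (pair m a + pair n b), add_comm' (pair m a), add_comm' (pair m a),
      add_comm' (pair n b) (pair k c), this]
  · rw [pair_add_of_eq _ _ h, pair_add_of_eq _ _ h']
    rcases odot_or (a ⊙ₘ b) c with e | e
    · rw [pair_add_of_odot _ _ e, pair_add_of_odot _ _ (by rw [← odot_assoc, e]),
        odot_oplus_assoc' h h']
      congr 1; ring
    · rw [pair_add_of_eq _ _ e, pair_add_of_eq _ _ (by rw [← odot_oplus_assoc' h h', e]),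
        odot_assoc]
      congr 1; ring

theorem zero_add' (x : Chang A) : 0 + x = x := by
  obtain ⟨m, a, rfl⟩ := exists_pair x
  rw [zero_def, pair_add_of_odot _ _ (zero_odot a), zero_oplus, zero_add]

noncomputable instance : AddCommGroup (Chang A) where
  add_assoc := add_assoc'
  zero_add := zero_add'
  add_zero x := by rw [add_comm', zero_add']
  nsmul := nsmulRec
  zsmul := zsmulRec
  neg_add_cancel x := by
    obtain ⟨m, a, rfl⟩ := exists_pair x
    rw [neg_pair, add_comm', pair_add_of_eq _ _ (oplus_mneg a), odot_mneg, zero_def]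
    congr 1; ring
  add_comm := add_comm'

/-- `x ≤ y` iff `x = (m, a)` and `y = (n, b)` with `m < n`, or `m = n` and `a ≤ b`. -/
instance {A : Type*} [MVAlgebra A] : LE (Chang A) where
  le x y := ∃ m a n b, x = pair m a ∧ y = pair n b ∧ (m < n ∨ m = n ∧ a ≤ b)

theorem le_iff_sub (x y : Chang A) : x ≤ y ↔ ∃ k c, 0 ≤ k ∧ y - x = pair k c := by
  constructor
  · rintro ⟨m, a, n, b, rfl, rfl, h⟩
    rw [sub_eq_add_neg, neg_pair]
    rcases h with h | ⟨rfl, h⟩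
    · rcases odot_or b (¬ₘa) with e | e
      · exact ⟨_, _, by omega, pair_add_of_odot _ _ e⟩
      · exact ⟨_, _, by omega, pair_add_of_eq _ _ e⟩
    · have e : b ⊕ₘ ¬ₘa = mtop A := by rw [oplus_comm]; exact le_iff.1 h
      exact ⟨_, _, by omega, pair_add_of_eq _ _ e⟩
  · rintro ⟨k, c, hk, h⟩
    obtain ⟨m, a, rfl⟩ := exists_pair x
    have hy : y = pair m a + pair k c := by rw [← h]; abel
    rcases odot_or a c with e | e
    · rw [pair_add_of_odot _ _ e] at hy
      refine ⟨m, a, _, _, rfl, hy, ?_⟩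
      rcases hk.lt_or_eq with hk | hk
      · left; omega
      · right; exact ⟨by omega, le_oplus_right a c⟩
    · rw [pair_add_of_eq _ _ e] at hy
      exact ⟨m, a, _, _, rfl, hy, Or.inl (by omega)⟩

open Classical in
/-- The representative `(m, a)` with `a ≠ u`; it separates classes if `0 ≠ u`. -/
noncomputable def norm {A : Type*} [MVAlgebra A] (h0 : (0 : A) ≠ mtop A) : Chang A → ℤ × A :=
  Quot.lift (fun p => if p.2 = mtop A then (p.1 + 1, 0) else p) (by
    rintro _ _ ⟨m⟩; simp [h0])

open Classical in
theorem norm_pair {A : Type*} [MVAlgebra A] (h0 : (0 : A) ≠ mtop A) (m : ℤ) (a : A) :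
    norm h0 (pair m a) = if a = mtop A then (m + 1, 0) else (m, a) := rfl

theorem eq_zero_of_triv {A : Type*} [MVAlgebra A] (h0 : (0 : A) = mtop A) (x : Chang A) :
    x = 0 := by
  obtain ⟨m, a, rfl⟩ := exists_pair x
  have ha : a = 0 := le_antisymm (h0 ▸ le_mtop a) (zero_le' a)
  subst ha
  have key : ∀ n : ℤ, pair n (0 : A) = pair (n + 1) (0 : A) := fun n => by
    have h := glue (A := A) n
    rwa [← h0] at h
  rw [zero_def]
  induction m using Int.induction_on with
  | zero => rfl
  | succ i hi => rw [← key, hi]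
  | pred i hi => rw [key, sub_add_cancel, hi]

theorem cone_antisymm {k l : ℤ} {c d : A} (hk : 0 ≤ k) (hl : 0 ≤ l)
    (h : pair k c = -pair l d) : pair k c = 0 := by
  by_cases h0 : (0 : A) = mtop A
  · exact eq_zero_of_triv h0 _
  · have e := congrArg (norm h0) h
    rw [neg_pair, norm_pair, norm_pair] at e
    split_ifs at e with h1 h2 h2 <;> rw [Prod.mk.injEq] at e <;> obtain ⟨e1, e2⟩ := e
    · omega
    · omega
    · have : k = 0 := by omega
      rw [this, e2]; rfl
    · omega

theorem sub_cone_add {k l : ℤ} (c d : A) (hk : 0 ≤ k) (hl : 0 ≤ l) :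
    ∃ n e, 0 ≤ n ∧ pair k c + pair l d = pair n e := by
  rcases odot_or c d with e | e
  · exact ⟨_, _, by omega, pair_add_of_odot _ _ e⟩
  · exact ⟨_, _, by omega, pair_add_of_eq _ _ e⟩

open Classical in
/-- `A^*` is totally ordered; its lattice operations are `min` and `max`. -/
noncomputable instance : LinearOrder (Chang A) where
  le x y := x ≤ y
  le_refl x := (le_iff_sub x x).2 ⟨0, 0, le_refl _, by rw [sub_self]; rfl⟩
  le_trans x y z h h' := by
    obtain ⟨k, c, hk, h⟩ := (le_iff_sub _ _).1 h
    obtain ⟨l, d, hl, h'⟩ := (le_iff_sub _ _).1 h'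
    obtain ⟨n, e, hn, hs⟩ := sub_cone_add c d hk hl
    exact (le_iff_sub _ _).2 ⟨n, e, hn, by rw [← hs, ← h, ← h']; abel⟩
  le_antisymm x y h h' := by
    obtain ⟨k, c, hk, h⟩ := (le_iff_sub _ _).1 h
    obtain ⟨l, d, hl, h'⟩ := (le_iff_sub _ _).1 h'
    have := cone_antisymm hk hl (c := c) (d := d) (by rw [← h, ← h']; abel)
    rw [← h] at this
    exact (sub_eq_zero.1 this).symm
  le_total x y := by
    rw [le_iff_sub, le_iff_sub]
    obtain ⟨m, a, h⟩ := exists_pair (y - x)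
    rcases le_or_gt 0 m with hm | hm
    · exact Or.inl ⟨m, a, hm, h⟩
    · exact Or.inr ⟨-m - 1, ¬ₘa, by omega, by rw [← neg_pair, ← h]; abel⟩
  toDecidableLE := Classical.decRel _

instance : IsOrderedAddMonoid (Chang A) where
  add_le_add_left x y h z := by
    obtain ⟨k, c, hk, h⟩ := (le_iff_sub _ _).1 h
    exact (le_iff_sub _ _).2 ⟨k, c, hk, by rw [← h]; abel⟩

theorem nonneg_iff (x : Chang A) : 0 ≤ x ↔ ∃ k c, 0 ≤ k ∧ x = pair k c := by
  have := le_iff_sub 0 x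
  rwa [sub_zero] at this

/-- The embedding `a ↦ (0, a)`. -/
def inj {A : Type*} [MVAlgebra A] (a : A) : Chang A := pair 0 a

theorem inj_zero {A : Type*} [MVAlgebra A] : inj (0 : A) = 0 := rfl

theorem inj_oplus {A : Type*} [MVAlgebra A] {a b : A} (h : a ⊙ₘ b = 0) :
    inj (a ⊕ₘ b) = inj a + inj b := by
  unfold inj; rw [pair_add_of_odot _ _ h, add_zero]

theorem inj_nonneg (a : A) : 0 ≤ inj a := (nonneg_iff _).2 ⟨0, a, le_refl _, rfl⟩

theorem inj_mono {a b : A} (h : a ≤ b) : inj a ≤ inj b := ⟨0, a, 0, b, rfl, rfl, Or.inr ⟨rfl, h⟩⟩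

theorem zsmul_unit (m : ℤ) : m • inj (mtop A) = pair m 0 := by
  have h1 : ∀ n : ℤ, pair n (0 : A) + inj (mtop A) = pair (n + 1) 0 := fun n => by
    unfold inj
    rw [pair_add_of_odot _ _ (zero_odot _), zero_oplus, glue, add_zero]
  induction m using Int.induction_on with
  | zero => rw [zero_zsmul]; rfl
  | succ i hi => rw [add_zsmul, one_zsmul, hi, h1]
  | pred i hi =>
    rw [sub_zsmul, one_zsmul, hi, ← sub_eq_add_neg, sub_eq_iff_eq_add, h1, sub_add_cancel]

theorem pair_eq (m : ℤ) (a : A) : pair m a = m • inj (mtop A) + inj a := by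
  rw [zsmul_unit]; unfold inj; rw [pair_add_of_odot _ _ (zero_odot a), zero_oplus, add_zero]

/-- A map that is additive on the pairs with `a ⊙ b = 0` extends to `A^*`. -/
noncomputable def lift {A : Type*} [MVAlgebra A] [MVChain A] {G : Type*} [AddCommGroup G] (f : A → G)
    (hf : ∀ a b, a ⊙ₘ b = 0 → f (a ⊕ₘ b) = f a + f b) : Chang A →+ G :=
  have h0 : f 0 = 0 := by
    have := hf 0 0 (zero_odot 0)
    rwa [oplus_zero, left_eq_add] at this
  AddMonoidHom.mk'
    (Quot.lift (fun p => p.1 • f (mtop A) + f p.2) (by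
      rintro _ _ ⟨m⟩
      change m • f (mtop A) + f (mtop A) = (m + 1) • f (mtop A) + f 0
      rw [h0, add_zsmul, one_zsmul, add_zero])) (by
      intro x y
      obtain ⟨m, a, rfl⟩ := exists_pair x
      obtain ⟨n, b, rfl⟩ := exists_pair y
      rcases odot_or a b with h | h
      · rw [pair_add_of_odot _ _ h]
        change (m + n) • f (mtop A) + f (a ⊕ₘ b)
          = m • f (mtop A) + f a + (n • f (mtop A) + f b)
        rw [hf _ _ h, add_zsmul]; abel
      · rw [pair_add_of_eq _ _ h]
        change (m + n + 1) • f (mtop A) + f (a ⊙ₘ b)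
          = m • f (mtop A) + f a + (n • f (mtop A) + f b)
        have hle : ¬ₘa ≤ b := mneg_le_iff.2 h
        have e1 : b = a ⊙ₘ b ⊕ₘ ¬ₘa := by
          conv_lhs => rw [← ominus_oplus_of_le hle, ominus_eq, mneg_mneg, odot_comm]
        have e2 : f b = f (a ⊙ₘ b) + f (¬ₘa) := by
          conv_lhs => rw [e1]
          apply hf
          rw [odot_comm a b, odot_assoc, odot_mneg, odot_comm, zero_odot]
        have e3 : f (mtop A) = f a + f (¬ₘa) := by
          rw [← oplus_mneg a]; exact hf _ _ (odot_mneg a)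
        rw [e2, add_zsmul, add_zsmul, one_zsmul]
        have : f (mtop A) + f (a ⊙ₘ b) = f a + (f (a ⊙ₘ b) + f (¬ₘa)) := by rw [e3]; abel
        rw [add_assoc, this]; abel)

theorem lift_pair {G : Type*} [AddCommGroup G] (f : A → G)
    (hf : ∀ a b, a ⊙ₘ b = 0 → f (a ⊕ₘ b) = f a + f b) (m : ℤ) (a : A) :
    lift f hf (pair m a) = m • f (mtop A) + f a := rfl

end Group

section Ring

variable [PMVfAlgebra A] [MVChain A]

/-- `(m, a)(n, b)`, before passing to classes. -/
noncomputable def mulPair (p q : ℤ × A) : Chang A :=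
  (p.1 * q.1) • inj (mtop A * mtop A) + p.1 • inj (q.2 * mtop A) + q.1 • inj (p.2 * mtop A)
    + inj (p.2 * q.2)

theorem mulPair_comm (p q : ℤ × A) : mulPair p q = mulPair q p := by
  unfold mulPair; rw [mul_comm p.1, pmul_comm p.2 q.2]; abel

theorem mulPair_glue (m : ℤ) (q : ℤ × A) : mulPair (m, mtop A) q = mulPair (m + 1, 0) q := by
  unfold mulPair
  simp only [pzero_mul, inj_zero, smul_zero, add_zero]
  rw [pmul_comm (mtop A) q.2, add_mul, add_zsmul, add_zsmul, one_mul, one_zsmul]; abel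

/-- Product: `(m, a)(n, b) = mn(0, u²) + m(0, bu) + n(0, au) + (0, ab)`. -/
noncomputable instance : Mul (Chang A) where
  mul := Quot.lift₂ mulPair
    (by rintro p _ _ ⟨m⟩; rw [mulPair_comm, mulPair_glue, mulPair_comm])
    (by rintro _ _ q ⟨m⟩; rw [mulPair_glue])

theorem pair_mul (m n : ℤ) (a b : A) : pair m a * pair n b =
    (m * n) • inj (mtop A * mtop A) + m • inj (b * mtop A) + n • inj (a * mtop A) + inj (a * b) :=
  rfl

theorem inj_mul (a b : A) : inj a * inj b = inj (a * b) := by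
  unfold inj; rw [pair_mul]; simp only [mul_zero, zero_zsmul, zero_add]; rfl

/-- Multiplication by `(0, a)` as an additive map. -/
noncomputable def mulHom (a : A) : Chang A →+ Chang A :=
  lift (fun b => inj (a * b)) (fun b c h => by rw [pmul_oplus h, inj_oplus (pmul_odot h a)])

theorem pair_mul_eq (m : ℤ) (a : A) (y : Chang A) :
    pair m a * y = m • mulHom (mtop A) y + mulHom a y := by
  obtain ⟨n, b, rfl⟩ := exists_pair y
  unfold mulHom
  rw [lift_pair, lift_pair, pair_mul, smul_add, smul_smul, pmul_comm b]; abel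

theorem mul_comm' (x y : Chang A) : x * y = y * x := by
  obtain ⟨m, a, rfl⟩ := exists_pair x
  obtain ⟨n, b, rfl⟩ := exists_pair y
  exact mulPair_comm _ _

theorem mul_add' (x y z : Chang A) : x * (y + z) = x * y + x * z := by
  obtain ⟨m, a, rfl⟩ := exists_pair x
  simp only [pair_mul_eq, map_add, smul_add]; abel

theorem mul_zero' (x : Chang A) : x * 0 = 0 := by
  obtain ⟨m, a, rfl⟩ := exists_pair x
  rw [pair_mul_eq, map_zero, map_zero, smul_zero, add_zero]

noncomputable instance instNonAssoc : NonUnitalNonAssocCommRing (Chang A) where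
  left_distrib := mul_add'
  right_distrib x y z := by rw [mul_comm', mul_add', mul_comm' z, mul_comm' z]
  zero_mul x := by rw [mul_comm', mul_zero']
  mul_zero := mul_zero'
  mul_comm := mul_comm'

noncomputable instance : NonUnitalCommRing (Chang A) where
  mul_assoc x y z := by
    obtain ⟨m, a, rfl⟩ := exists_pair x
    obtain ⟨n, b, rfl⟩ := exists_pair y
    obtain ⟨k, c, rfl⟩ := exists_pair z
    simp only [pair_eq, add_mul, mul_add, smul_mul_assoc, mul_smul_comm, inj_mul, pmul_assoc,
      smul_add]
  mul_comm := mul_comm'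

theorem mul_nonneg' {x y : Chang A} (hx : 0 ≤ x) (hy : 0 ≤ y) : 0 ≤ x * y := by
  obtain ⟨m, a, hm, rfl⟩ := (nonneg_iff _).1 hx
  obtain ⟨n, b, hn, rfl⟩ := (nonneg_iff _).1 hy
  rw [pair_mul]
  exact add_nonneg (add_nonneg (add_nonneg (zsmul_nonneg (inj_nonneg _) (mul_nonneg hm hn))
    (zsmul_nonneg (inj_nonneg _) hm)) (zsmul_nonneg (inj_nonneg _) hn)) (inj_nonneg _)

theorem exists_inj {A : Type*} [MVAlgebra A] [MVChain A] {x : Chang A} (h : 0 ≤ x)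
    (h' : x ≤ inj (mtop A)) : ∃ a, x = inj a := by
  obtain ⟨m, a, hm, rfl⟩ := (nonneg_iff _).1 h
  rcases hm.lt_or_eq with hm | hm
  · refine ⟨mtop A, le_antisymm h' ?_⟩
    exact ⟨0, mtop A, m, a, rfl, rfl, Or.inl hm⟩
  · exact ⟨a, by rw [← hm]; rfl⟩

theorem mul_le_inf' {x y : Chang A} (hx : 0 ≤ x) (hx' : x ≤ inj (mtop A)) (hy : 0 ≤ y)
    (hy' : y ≤ inj (mtop A)) : x * y ≤ x ⊓ y := by
  obtain ⟨a, rfl⟩ := exists_inj hx hx'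
  obtain ⟨b, rfl⟩ := exists_inj hy hy'
  rw [inj_mul]
  exact le_inf (inj_mono (pmul_le_left a b)) (inj_mono (pmul_le_right a b))

end Ring

section Map

variable {B : Type*} [PMVfAlgebra A] [PMVfAlgebra B]

/-- `h^♯ (m, a) = (m, h a)` for a homomorphism `h`. -/
def map (h : PMVfHom A B) : Chang A → Chang B :=
  Quot.lift (fun p => pair p.1 (h p.2)) (by
    rintro _ _ ⟨m⟩
    change pair m (h (mtop A)) = pair (m + 1) (h 0)
    rw [h.map_mtop, h.map_zero, glue])

theorem map_pair (h : PMVfHom A B) (m : ℤ) (a : A) : map h (pair m a) = pair m (h a) := rfl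

theorem map_inj (h : PMVfHom A B) (a : A) : map h (inj a) = inj (h a) := rfl

variable [MVChain A] [MVChain B]

theorem map_add (h : PMVfHom A B) (x y : Chang A) : map h (x + y) = map h x + map h y := by
  obtain ⟨m, a, rfl⟩ := exists_pair x
  obtain ⟨n, b, rfl⟩ := exists_pair y
  rcases odot_or a b with e | e
  · rw [pair_add_of_odot _ _ e, map_pair, map_pair, map_pair, pair_add_of_odot, h.map_oplus]
    rw [← h.map_odot, e, h.map_zero]
  · rw [pair_add_of_eq _ _ e, map_pair, map_pair, map_pair, pair_add_of_eq, h.map_odot]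
    rw [← h.map_oplus, e, h.map_mtop]

/-- `map h` as an additive map. -/
noncomputable def mapHom (h : PMVfHom A B) : Chang A →+ Chang B := AddMonoidHom.mk' (map h) (map_add h)

theorem map_mul (h : PMVfHom A B) (x y : Chang A) : map h (x * y) = map h x * map h y := by
  obtain ⟨m, a, rfl⟩ := exists_pair x
  obtain ⟨n, b, rfl⟩ := exists_pair y
  have e : ∀ c, mapHom h (inj c) = inj (h c) := fun _ => rfl
  change mapHom h _ = _
  rw [map_pair, map_pair, pair_mul, pair_mul]
  simp only [_root_.map_add, map_zsmul, e, h.map_mul, h.map_mtop]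

theorem map_mono (h : PMVfHom A B) : Monotone (map h) := by
  rintro x y ⟨m, a, n, b, rfl, rfl, e⟩
  exact ⟨m, h a, n, h b, rfl, rfl, e.imp id (fun e => ⟨e.1, h.mono e.2⟩)⟩

end Map

end Chang

end Chang

/-! ### Semi-low `l_u`-rings -/

/-- Semi-low `l_u`-rings `(R, u)`: commutative rings (not necessarily with `1`) on a lattice-ordered
abelian group such that products of nonnegative elements are nonnegative, with a strong unit `u`
such that `ab ≤ a ∧ b` for `a, b ∈ [0, u]`. -/
class SemiLowRing (R : Type*) extends NonUnitalCommRing R, Lattice R, IsOrderedAddMonoid R where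
  mul_nonneg' : ∀ x y : R, 0 ≤ x → 0 ≤ y → 0 ≤ x * y
  u : R
  u_nonneg : 0 ≤ u
  u_strong : ∀ x : R, ∃ n : ℕ, |x| ≤ n • u
  semiLow : ∀ a b : R, 0 ≤ a → a ≤ u → 0 ≤ b → b ≤ u → a * b ≤ a ⊓ b

/-- Homomorphisms of `l_u`-rings: they preserve `+`, `·`, `∨`, `∧` and the strong unit. -/
@[ext]
structure LuHom (R S : Type*) [SemiLowRing R] [SemiLowRing S] where
  toFun : R → S
  map_add' : ∀ x y, toFun (x + y) = toFun x + toFun y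
  map_mul' : ∀ x y, toFun (x * y) = toFun x * toFun y
  map_sup' : ∀ x y, toFun (x ⊔ y) = toFun x ⊔ toFun y
  map_inf' : ∀ x y, toFun (x ⊓ y) = toFun x ⊓ toFun y
  map_u' : toFun SemiLowRing.u = SemiLowRing.u

section Lu

variable {R S T : Type*} [SemiLowRing R] [SemiLowRing S] [SemiLowRing T]

instance : FunLike (LuHom R S) R S where
  coe f := f.toFun
  coe_injective f g h := by ext x; exact congrFun h x

/-- The identity homomorphism. -/
def LuHom.id (R : Type*) [SemiLowRing R] : LuHom R R :=
  ⟨fun x => x, fun _ _ => rfl, fun _ _ => rfl, fun _ _ => rfl, fun _ _ => rfl, rfl⟩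

theorem LuHom.map_add (f : LuHom R S) (x y : R) : f (x + y) = f x + f y := f.map_add' x y
theorem LuHom.map_mul (f : LuHom R S) (x y : R) : f (x * y) = f x * f y := f.map_mul' x y
theorem LuHom.map_sup (f : LuHom R S) (x y : R) : f (x ⊔ y) = f x ⊔ f y := f.map_sup' x y
theorem LuHom.map_inf (f : LuHom R S) (x y : R) : f (x ⊓ y) = f x ⊓ f y := f.map_inf' x y
theorem LuHom.map_u (f : LuHom R S) : f SemiLowRing.u = SemiLowRing.u := f.map_u'
theorem LuHom.map_zero (f : LuHom R S) : f 0 = 0 := by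
  have := f.map_add 0 0
  rwa [add_zero, left_eq_add] at this
theorem LuHom.map_sub (f : LuHom R S) (x y : R) : f (x - y) = f x - f y := by
  rw [eq_sub_iff_add_eq, ← f.map_add, sub_add_cancel]
theorem LuHom.mono (f : LuHom R S) {x y : R} (h : x ≤ y) : f x ≤ f y := by
  rw [← inf_eq_left] at *; rw [← f.map_inf, h]

/-- Composition of homomorphisms. -/
def LuHom.comp (g : LuHom S T) (f : LuHom R S) : LuHom R T where
  toFun x := g (f x)
  map_add' x y := by rw [f.map_add, g.map_add]
  map_mul' x y := by rw [f.map_mul, g.map_mul]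
  map_sup' x y := by rw [f.map_sup, g.map_sup]
  map_inf' x y := by rw [f.map_inf, g.map_inf]
  map_u' := by rw [f.map_u, g.map_u]

/-! ### The functor `Γ` on objects and morphisms -/

/-- The segment `Γ(R, u) = [0, u]`. -/
def Segment (R : Type*) [SemiLowRing R] : Type _ := {x : R // 0 ≤ x ∧ x ≤ SemiLowRing.u}

namespace Segment

open SemiLowRing

theorem mul_le_left' {a b : R} (ha : 0 ≤ a ∧ a ≤ u) (hb : 0 ≤ b ∧ b ≤ u) : a * b ≤ a :=
  le_trans (semiLow a b ha.1 ha.2 hb.1 hb.2) inf_le_left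

theorem mul_le_right' {a b : R} (ha : 0 ≤ a ∧ a ≤ u) (hb : 0 ≤ b ∧ b ≤ u) : a * b ≤ b :=
  le_trans (semiLow a b ha.1 ha.2 hb.1 hb.2) inf_le_right

theorem mul_sub_sup {a b c : R} (ha : 0 ≤ a ∧ a ≤ u) (hb : 0 ≤ b ∧ b ≤ u) (hc : 0 ≤ c ∧ c ≤ u) :
    a * ((b - c) ⊔ 0) = (a * b - a * c) ⊔ 0 := by
  have hp : 0 ≤ (b - c) ⊔ 0 ∧ (b - c) ⊔ 0 ≤ u :=
    ⟨le_sup_right, sup_le (le_trans (sub_le_self _ hc.1) hb.2) u_nonneg⟩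
  have hq : 0 ≤ -(b - c) ⊔ 0 ∧ -(b - c) ⊔ 0 ≤ u :=
    ⟨le_sup_right, sup_le (by rw [neg_sub]; exact le_trans (sub_le_self _ hb.1) hc.2) u_nonneg⟩
  have hpq : ((b - c) ⊔ 0) ⊓ (-(b - c) ⊔ 0) = 0 := posPart_inf_negPart_eq_zero (b - c)
  have hs : ((b - c) ⊔ 0) - (-(b - c) ⊔ 0) = b - c := posPart_sub_negPart (b - c)
  generalize (b - c) ⊔ 0 = p at *
  generalize -(b - c) ⊔ 0 = q at *
  have h0 : (a * p) ⊓ (a * q) = 0 := by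
    apply le_antisymm
    · rw [← hpq]; exact inf_le_inf (mul_le_right' ha hp) (mul_le_right' ha hq)
    · exact le_inf (mul_nonneg' _ _ ha.1 hp.1) (mul_nonneg' _ _ ha.1 hq.1)
  have : a * p - (a * p) ⊓ (a * q) = (a * p - a * p) ⊔ (a * p - a * q) := sub_inf _ _ _
  rw [h0, sub_zero, sub_self, ← mul_sub, hs, mul_sub, sup_comm] at this
  exact this

/-- The operations `x ⊕ y = (x + y) ∧ u`, `¬x = u - x` on `[0, u]`. -/
instance instMV : MVAlgebra (Segment R) where
  zero := ⟨0, le_refl _, u_nonneg⟩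
  oplus x y := ⟨(x.1 + y.1) ⊓ u, le_inf (add_nonneg x.2.1 y.2.1) u_nonneg, inf_le_right⟩
  mneg x := ⟨u - x.1, sub_nonneg.2 x.2.2, sub_le_self _ x.2.1⟩
  oplus_assoc x y z := by
    apply Subtype.ext
    change ((x.1 + y.1) ⊓ u + z.1) ⊓ u = (x.1 + (y.1 + z.1) ⊓ u) ⊓ u
    rw [inf_add, add_inf, inf_assoc, inf_assoc, inf_eq_right.2 (le_add_of_nonneg_right z.2.1),
      inf_eq_right.2 (le_add_of_nonneg_left x.2.1), add_assoc]
  oplus_comm x y := by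
    apply Subtype.ext
    change (x.1 + y.1) ⊓ u = (y.1 + x.1) ⊓ u
    rw [add_comm]
  oplus_zero x := by
    apply Subtype.ext
    change (x.1 + 0) ⊓ u = x.1
    rw [add_zero, inf_eq_left.2 x.2.2]
  mneg_mneg x := by
    apply Subtype.ext
    change u - (u - x.1) = x.1
    abel
  oplus_top x := by
    apply Subtype.ext
    change (x.1 + (u - 0)) ⊓ u = u - 0
    rw [sub_zero, inf_eq_right.2 (le_add_of_nonneg_left x.2.1)]
  luk x y := by
    apply Subtype.ext
    change (u - (u - x.1 + y.1) ⊓ u + y.1) ⊓ u = (u - (u - y.1 + x.1) ⊓ u + x.1) ⊓ u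
    rw [sub_inf, sub_inf, sup_add, sup_add, sub_self, zero_add, zero_add, sup_comm]
    congr 2 <;> abel

theorem val_ominus (x y : Segment R) : (x ⊖ₘ y).1 = (x.1 - y.1) ⊔ 0 := by
  change u - (u - x.1 + y.1) ⊓ u = _
  rw [sub_inf, sub_self]; congr 1; abel

theorem le_iff_val {x y : Segment R} : x ≤ y ↔ x.1 ≤ y.1 := by
  have h : x ≤ y ↔ (x ⊖ₘ y).1 = 0 := ⟨fun h => congrArg Subtype.val h, fun h => Subtype.ext h⟩
  rw [h, val_ominus, sup_eq_right, sub_nonpos]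

/-- The product of `[0, u]` is that of `R`. -/
instance : Mul (Segment R) where
  mul x y := ⟨x.1 * y.1, mul_nonneg' _ _ x.2.1 y.2.1, le_trans (mul_le_left' x.2 y.2) x.2.2⟩

theorem val_mul (x y : Segment R) : (x * y).1 = x.1 * y.1 := rfl

theorem mul_ominus' (a b c : Segment R) : a * (b ⊖ₘ c) = a * b ⊖ₘ a * c := by
  apply Subtype.ext
  rw [val_mul, val_ominus, val_ominus, mul_sub_sup a.2 b.2 c.2]; rfl

instance : PMVfAlgebra (Segment R) where
  mul_assoc a b c := Subtype.ext (mul_assoc a.1 b.1 c.1)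
  mul_comm a b := Subtype.ext (mul_comm a.1 b.1)
  mul_zero a := Subtype.ext (mul_zero a.1)
  mul_oplus_le a b c := by
    rw [le_iff_val]
    change a.1 * ((b.1 + c.1) ⊓ u) ≤ (a.1 * b.1 + a.1 * c.1) ⊓ u
    apply le_inf
    · rw [← mul_add, ← sub_nonneg, ← mul_sub]
      exact mul_nonneg' _ _ a.2.1 (sub_nonneg.2 inf_le_left)
    · exact le_trans (mul_le_left' a.2 (b ⊕ₘ c).2) a.2.2
  le_mul_ominus a b c := by rw [mul_ominus']
  mul_le_inf a b :=
    le_inf (le_iff_val.2 (mul_le_left' a.2 b.2)) (le_iff_val.2 (mul_le_right' a.2 b.2))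
  mul_ominus := mul_ominus'

/-- `Γ(h) = h|_{[0, u]}`. -/
def map (h : LuHom R S) : PMVfHom (Segment R) (Segment S) where
  toFun x := ⟨h x.1, by rw [← h.map_zero]; exact h.mono x.2.1,
    by rw [← h.map_u]; exact h.mono x.2.2⟩
  map_zero' := Subtype.ext h.map_zero
  map_oplus' x y := by
    apply Subtype.ext
    change h ((x.1 + y.1) ⊓ u) = (h x.1 + h y.1) ⊓ u
    rw [h.map_inf, h.map_add, h.map_u]
  map_mneg' x := by
    apply Subtype.ext
    change h (u - x.1) = u - h x.1
    rw [h.map_sub, h.map_u]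
  map_mul' x y := Subtype.ext (h.map_mul x.1 y.1)

end Segment

end Lu

/-! ### The functor `(-)^♯` on objects and morphisms -/

section Sharp

variable {A B C : Type*} [PMVfAlgebra A] [PMVfAlgebra B] [PMVfAlgebra C]

/-- The `l`-ring `∏_P (A/P)^♯`, with componentwise operations and order. -/
abbrev SharpProd (A : Type*) [PMVfAlgebra A] : Type _ := ∀ P : Spec A, Chang P.1.Quo

/-- The element `(0, â)` of the product, with components `(0, [a]_P)`. -/
def hat (a : A) : SharpProd A := fun P => Chang.inj (P.1.cls a)

/-- Subrings of `∏_P (A/P)^♯` that contain `A° = {(0, â) : a ∈ A}` and are closed under the lattice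
operations. -/
def IsLSubring (T : NonUnitalSubring (SharpProd A)) : Prop :=
  (∀ a : A, hat a ∈ T) ∧ ∀ x ∈ T, ∀ y ∈ T, x ⊔ y ∈ T ∧ x ⊓ y ∈ T

/-- The `l`-subring of `∏_P (A/P)^♯` generated by `A°`. -/
noncomputable def sharpSubring (A : Type*) [PMVfAlgebra A] : NonUnitalSubring (SharpProd A) :=
  sInf {T | IsLSubring T}

theorem mem_sharpSubring {x : SharpProd A} :
    x ∈ sharpSubring A ↔ ∀ T : NonUnitalSubring (SharpProd A), IsLSubring T → x ∈ T :=
  NonUnitalSubring.mem_sInf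

theorem isLSubring_sharp : IsLSubring (sharpSubring A) := by
  refine ⟨fun a => mem_sharpSubring.2 fun T hT => hT.1 a, fun x hx y hy => ⟨?_, ?_⟩⟩
  · exact mem_sharpSubring.2 fun T hT =>
      (hT.2 x (mem_sharpSubring.1 hx T hT) y (mem_sharpSubring.1 hy T hT)).1
  · exact mem_sharpSubring.2 fun T hT =>
      (hT.2 x (mem_sharpSubring.1 hx T hT) y (mem_sharpSubring.1 hy T hT)).2

/-- The ring `A^♯`. -/
def Sharp (A : Type*) [PMVfAlgebra A] : Type _ := {x : SharpProd A // x ∈ sharpSubring A}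

noncomputable instance : NonUnitalCommRing (Sharp A) :=
  inferInstanceAs (NonUnitalCommRing (sharpSubring A))

noncomputable instance : Lattice (Sharp A) :=
  Subtype.lattice (fun _ _ hx hy => (isLSubring_sharp.2 _ hx _ hy).1)
    (fun _ _ hx hy => (isLSubring_sharp.2 _ hx _ hy).2)

/-- The map `A → A^♯`, `a ↦ (0, â)`. -/
def Sharp.of (a : A) : Sharp A := ⟨hat a, isLSubring_sharp.1 a⟩

theorem hat_nonneg (a : A) : 0 ≤ hat a := fun _ => Chang.inj_nonneg _

theorem hat_le (a : A) : hat a ≤ hat (mtop A) := fun P => Chang.inj_mono (P.1.proj.mono (le_mtop a))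

theorem Chang.mul_bound {D : Type*} [PMVfAlgebra D] [MVChain D] {x y : Chang D} {n m : ℕ}
    (hx : -(n • inj (mtop D)) ≤ x) (hx' : x ≤ n • inj (mtop D))
    (hy : -(m • inj (mtop D)) ≤ y) (hy' : y ≤ m • inj (mtop D)) :
    -((n * m) • inj (mtop D)) ≤ x * y ∧ x * y ≤ (n * m) • inj (mtop D) := by
  set w := inj (mtop D) with hw
  have hw2 : w * w ≤ w := by
    rw [hw, inj_mul]; exact inj_mono (pmul_le_left _ _)
  have hnm : (n • w) * (m • w) ≤ (n * m) • w := by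
    rw [smul_mul_assoc, mul_smul_comm, smul_smul]; exact nsmul_le_nsmul_right hw2 _
  have a1 : 0 ≤ n • w - x := sub_nonneg.2 hx'
  have a2 : 0 ≤ n • w + x := neg_le_iff_add_nonneg'.1 hx
  have b1 : 0 ≤ m • w - y := sub_nonneg.2 hy'
  have b2 : 0 ≤ m • w + y := neg_le_iff_add_nonneg'.1 hy
  have half : ∀ z : Chang D, 0 ≤ z + z → 0 ≤ z := fun z hz => by
    by_contra h
    exact absurd hz (not_le.2 (add_neg (not_le.1 h) (not_le.1 h)))
  generalize n • w = p at *
  generalize m • w = q at *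
  constructor
  · rw [neg_le_iff_add_nonneg']
    have h := half (p * q + x * y) (by
      have := add_nonneg (mul_nonneg' a1 b1) (mul_nonneg' a2 b2)
      have e : (p - x) * (q - y) + (p + x) * (q + y) = p * q + x * y + (p * q + x * y) := by
        simp only [sub_mul, mul_sub, add_mul, mul_add]; abel
      rwa [e] at this)
    exact le_trans h (by gcongr)
  · rw [← sub_nonneg]
    have h := half (p * q - x * y) (by
      have := add_nonneg (mul_nonneg' a1 b2) (mul_nonneg' a2 b1)
      have e : (p - x) * (q + y) + (p + x) * (q - y) = p * q - x * y + (p * q - x * y) := by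
        simp only [sub_mul, mul_sub, add_mul, mul_add]; abel
      rwa [e] at this)
    exact le_trans h (by gcongr)

/-- The elements of the product that lie between `-nu` and `nu` for some `n`. -/
def boundedSubring (A : Type*) [PMVfAlgebra A] : NonUnitalSubring (SharpProd A) where
  carrier := {x | ∃ n : ℕ, ∀ P, -(n • hat (mtop A) P) ≤ x P ∧ x P ≤ n • hat (mtop A) P}
  add_mem' := by
    rintro x y ⟨n, hx⟩ ⟨m, hy⟩
    refine ⟨n + m, fun P => ?_⟩
    rw [add_nsmul, neg_add]
    exact ⟨add_le_add (hx P).1 (hy P).1, add_le_add (hx P).2 (hy P).2⟩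
  zero_mem' := ⟨0, fun P => by rw [zero_nsmul, neg_zero]; exact ⟨le_refl _, le_refl _⟩⟩
  neg_mem' := by
    rintro x ⟨n, hx⟩
    exact ⟨n, fun P => ⟨neg_le_neg (hx P).2, neg_le.1 (hx P).1⟩⟩
  mul_mem' := by
    rintro x y ⟨n, hx⟩ ⟨m, hy⟩
    exact ⟨n * m, fun P => Chang.mul_bound (hx P).1 (hx P).2 (hy P).1 (hy P).2⟩

theorem isLSubring_bounded : IsLSubring (boundedSubring A) := by
  refine ⟨fun a => ⟨1, fun P => ?_⟩, ?_⟩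
  · rw [one_nsmul]
    exact ⟨le_trans (neg_nonpos.2 (hat_nonneg _ P)) (hat_nonneg a P), hat_le a P⟩
  · rintro x ⟨n, hx⟩ y ⟨m, hy⟩
    have h1 : ∀ P, n • hat (mtop A) P ≤ (n + m) • hat (mtop A) P := fun P =>
      nsmul_le_nsmul_left (hat_nonneg _ P) (by omega)
    have h2 : ∀ P, m • hat (mtop A) P ≤ (n + m) • hat (mtop A) P := fun P =>
      nsmul_le_nsmul_left (hat_nonneg _ P) (by omega)
    have hx1 := fun P => le_trans (neg_le_neg (h1 P)) (hx P).1
    have hy1 := fun P => le_trans (neg_le_neg (h2 P)) (hy P).1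
    have hx2 := fun P => le_trans (hx P).2 (h1 P)
    have hy2 := fun P => le_trans (hy P).2 (h2 P)
    exact ⟨⟨n + m, fun P => ⟨le_trans (hx1 P) le_sup_left, sup_le (hx2 P) (hy2 P)⟩⟩,
      ⟨n + m, fun P => ⟨le_inf (hx1 P) (hy1 P), le_trans inf_le_left (hx2 P)⟩⟩⟩

/-- `A^♯` is a semi-low `l_u`-ring with strong unit `(0, û)`. -/
noncomputable instance : SemiLowRing (Sharp A) where
  add_le_add_left x y h z P := by
    have := h P
    change x.1 P + z.1 P ≤ y.1 P + z.1 P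
    gcongr
  mul_nonneg' x y hx hy P := Chang.mul_nonneg' (hx P) (hy P)
  u := Sharp.of (mtop A)
  u_nonneg := hat_nonneg _
  u_strong x := by
    obtain ⟨n, hn⟩ := mem_sharpSubring.1 x.2 _ isLSubring_bounded
    exact ⟨n, sup_le (fun P => (hn P).2) (fun P => neg_le.1 (hn P).1)⟩
  semiLow a b ha ha' hb hb' P := Chang.mul_le_inf' (ha P) (ha' P) (hb P) (hb' P)

/-- `σ ↦ (Q ↦ (h|_Q)^♯ (σ (h⁻¹Q)))`. -/
noncomputable def prodMap (h : PMVfHom A B) : SharpProd A →ₙ+* SharpProd B where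
  toFun x Q := Chang.map (h.restr Q) (x (Spec.comap h Q))
  map_mul' _ _ := funext fun _ => Chang.map_mul _ _ _
  map_zero' := funext fun Q => (Chang.mapHom (h.restr Q)).map_zero
  map_add' _ _ := funext fun _ => Chang.map_add _ _ _

theorem prodMap_hat (h : PMVfHom A B) (a : A) : prodMap h (hat a) = hat (h a) := rfl

theorem prodMap_sup (h : PMVfHom A B) (x y : SharpProd A) :
    prodMap h (x ⊔ y) = prodMap h x ⊔ prodMap h y := funext fun Q =>
  (Chang.map_mono (h.restr Q)).map_sup _ _

theorem prodMap_inf (h : PMVfHom A B) (x y : SharpProd A) :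
    prodMap h (x ⊓ y) = prodMap h x ⊓ prodMap h y := funext fun Q =>
  (Chang.map_mono (h.restr Q)).map_inf _ _

theorem prodMap_mem (h : PMVfHom A B) {x : SharpProd A} (hx : x ∈ sharpSubring A) :
    prodMap h x ∈ sharpSubring B := by
  refine mem_sharpSubring.1 hx ((sharpSubring B).comap (prodMap h)) ⟨fun a => ?_, fun x hx y hy => ?_⟩
  · exact isLSubring_sharp.1 (h a)
  · have := isLSubring_sharp.2 _ hx _ hy
    rw [← prodMap_sup, ← prodMap_inf] at this
    exact this

/-- `h^♯ : A^♯ → B^♯`, the restriction of `prodMap h`; it sends `∑ εᵢ (0, âᵢ)` to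
`∑ εᵢ (0, (h aᵢ)^)`. -/
noncomputable def Sharp.map (h : PMVfHom A B) : LuHom (Sharp A) (Sharp B) where
  toFun x := ⟨prodMap h x.1, prodMap_mem h x.2⟩
  map_add' x y := Subtype.ext (map_add (prodMap h) x.1 y.1)
  map_mul' x y := Subtype.ext (map_mul (prodMap h) x.1 y.1)
  map_sup' x y := Subtype.ext (prodMap_sup h x.1 y.1)
  map_inf' x y := Subtype.ext (prodMap_inf h x.1 y.1)
  map_u' := Subtype.ext (congrArg hat h.map_mtop)

theorem Sharp.map_of (h : PMVfHom A B) (a : A) : Sharp.map h (Sharp.of a) = Sharp.of (h a) := rfl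

end Sharp

/-! ### The categories and functors -/

/-- The category of `PMV_f`-algebras. -/
structure PMVfCat where
  carrier : Type v
  [str : PMVfAlgebra carrier]

attribute [instance] PMVfCat.str

instance : CoeSort PMVfCat.{v} (Type v) := ⟨PMVfCat.carrier⟩

instance : Category PMVfCat.{v} where
  Hom A B := PMVfHom A B
  id A := PMVfHom.id A
  comp f g := PMVfHom.comp g f

instance : ConcreteCategory PMVfCat.{v} (fun A B => PMVfHom A B) where
  hom f := f
  ofHom f := f

/-- The category of semi-low `l_u`-rings. -/
structure LRuCat where
  carrier : Type v
  [str : SemiLowRing carrier]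

attribute [instance] LRuCat.str

instance : CoeSort LRuCat.{v} (Type v) := ⟨LRuCat.carrier⟩

instance : Category LRuCat.{v} where
  Hom R S := LuHom R S
  id R := LuHom.id R
  comp f g := LuHom.comp g f

instance : ConcreteCategory LRuCat.{v} (fun R S => LuHom R S) where
  hom f := f
  ofHom f := f

/-- The functor `Γ`, `(R, u) ↦ [0, u]`. -/
def Gamma : LRuCat.{v} ⥤ PMVfCat.{v} where
  obj R := ⟨Segment R⟩
  map h := Segment.map h
  map_id _ := rfl
  map_comp _ _ := rfl

/-- The functor `(-)^♯`. -/
noncomputable def sharp : PMVfCat.{v} ⥤ LRuCat.{v} where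
  obj A := ⟨Sharp A⟩
  map h := Sharp.map h
  map_id A := by
    apply LuHom.ext
    funext x
    apply Subtype.ext
    funext P
    change Chang.map (PMVfHom.restr (PMVfHom.id A) P) (x.1 P) = x.1 P
    obtain ⟨m, a, e⟩ := Chang.exists_pair (x.1 P)
    obtain ⟨a, rfl⟩ := P.1.cls_surj a
    rw [e]; rfl
  map_comp {A B C} f g := by
    apply LuHom.ext
    funext x
    apply Subtype.ext
    funext P
    change Chang.map (PMVfHom.restr (PMVfHom.comp g f) P)
        (x.1 (Spec.comap f (Spec.comap g P))) =
      Chang.map (PMVfHom.restr g P) (Chang.map (PMVfHom.restr f (Spec.comap g P))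
        (x.1 (Spec.comap f (Spec.comap g P))))
    obtain ⟨m, a, e⟩ := Chang.exists_pair (x.1 (Spec.comap f (Spec.comap g P)))
    obtain ⟨a, rfl⟩ := (Spec.comap f (Spec.comap g P)).1.cls_surj a
    rw [e]; rfl

end PMV

/-! Everything rests on one fact about an abelian `l`-group with `u ≥ 0`. Let `S ⊆ [0, u]` contain
`0` and be closed under `u - x` and truncated sum. Then the subgroup `G` generated by `S` is a
sublattice and `G ∩ [0, u] = S`. The reason is Mundici's good sequences: `x` is studied through its
truncations `trunc u (x - n • u)`, `n ∈ ℤ`. Adding an element of `S` changes them by MV-operations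
only (`trunc_add`), so for `x ∈ G` they all lie in `S`. An `x ∈ [0, u]` is its own truncation at
level `0`, and the positive part of `x` is a finite sum of truncations (`sup_zero_eq_sum_trunc`),
hence lies in `G`.

The fact is used twice. For `S = {(0, â)}` in the product of the chains `(A/P)^♯`, the group `G` is
also closed under products, so it contains all of `A^♯`, and `[0, u]` in `A^♯` is exactly `S`. Since
prime ideals separate points, `a ↦ (0, â)` is therefore a bijection onto `Γ(A^♯)`.

For a homomorphism `h : Γ(R) → Γ(S)`, the graph of `h` satisfies the same conditions in `R × S`, so
it generates a sub-`l`-ring. This is again the graph of a map: it is total because `[0, u]`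
generates `R`, and single-valued because the truncations of `(0, y)` at levels `n ≥ 0` are of the
form `(0, h 0)`, which forces `y ≤ 0`. Hence `Γ` is fully faithful, and `τ_R` is the map whose image
under `Γ` is inverse to the isomorphism `Γ(R) ≅ Γ(Γ(R)^♯)`. -/

namespace PMV

/-! ### Segments of abelian `l`-groups -/

section LGroup

variable {L : Type*} [AddCommGroup L] [Lattice L] [IsOrderedAddMonoid L]

theorem lgroup_sup_inf_right (a b c : L) : a ⊓ b ⊔ c = (a ⊔ c) ⊓ (b ⊔ c) :=
  letI := AddCommGroup.toDistribLattice L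
  sup_inf_right a b c

/-- The truncation `(x ∨ 0) ∧ u` of `x` to the segment `[0, u]`. -/
def trunc (u x : L) : L := (x ⊔ 0) ⊓ u

theorem trunc_of_mem {u x : L} (h0 : 0 ≤ x) (h : x ≤ u) : trunc u x = x := by
  rw [trunc, sup_eq_left.2 h0, inf_eq_left.2 h]

theorem trunc_of_nonpos {u x : L} (hu : 0 ≤ u) (h : x ≤ 0) : trunc u x = 0 := by
  rw [trunc, sup_eq_right.2 h, inf_eq_left.2 hu]

theorem trunc_of_le {u x : L} (hu : 0 ≤ u) (h : u ≤ x) : trunc u x = u := by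
  rw [trunc, sup_eq_left.2 (hu.trans h), inf_eq_right.2 h]

/-- In MV notation the right side is `trunc x ⊕ (trunc (x + u) ⊙ s)`, so truncations of `x + s` are
MV-expressions in `s` and truncations of translates of `x` by multiples of `u`. The `⊙` term
collapses to `(x ∧ 0 + s) ∨ 0`, the part of `s` left after cancelling the negative part of `x`.
Adding it to `x ∨ 0` gives `(x + s) ∨ 0`, because `x ∨ 0 + x ∧ 0 = x`. -/
theorem trunc_add {u s : L} (x : L) (hs : 0 ≤ s) (hsu : s ≤ u) :
    trunc u (x + s) = (trunc u x + ((trunc u (x + u) + s - u) ⊔ 0)) ⊓ u := by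
  have h1 : (trunc u (x + u) + s - u) ⊔ 0 = (x ⊓ 0 + s) ⊔ 0 := by
    have e : trunc u (x + u) + s - u = ((x + s) ⊔ (s - u)) ⊓ s := by
      rw [trunc, add_sub_assoc, inf_add, sup_add, zero_add]
      congr 2 <;> abel
    rw [e, lgroup_sup_inf_right, sup_assoc, sup_eq_right.2 (sub_nonpos.2 hsu), inf_add, zero_add,
      lgroup_sup_inf_right]
  have h2 : x ⊔ 0 + ((x ⊓ 0 + s) ⊔ 0) = (x + s) ⊔ 0 := by
    rw [add_sup, add_zero, ← add_assoc, add_comm (x ⊔ 0), inf_add_sup, add_zero, ← sup_assoc,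
      sup_eq_left.2 (le_add_of_nonneg_right hs)]
  -- The inner cut at `u`, applied before the second summand is added, is absorbed by the outer one.
  have h3 : u ≤ u + ((x ⊓ 0 + s) ⊔ 0) := le_add_of_nonneg_right le_sup_right
  rw [h1, trunc, trunc, inf_add, h2, inf_assoc, inf_eq_right.2 h3]

/-- Slice the positive part into layers of height `u`: one layer is `y ∨ 0 = trunc u y + (y - u) ∨
0`, and this is iterated. The remainder vanishes as soon as `x ≤ n • u`. -/
theorem sup_zero_eq_sum_trunc {u : L} (hu : 0 ≤ u) (x : L) (n : ℕ) :
    x ⊔ 0 = ∑ i ∈ Finset.range n, trunc u (x - (i : ℤ) • u) + (x - (n : ℤ) • u) ⊔ 0 := by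
  induction n with
  | zero => simp
  | succ n ih =>
    have step : ∀ y : L, y ⊔ 0 = trunc u y + (y - u) ⊔ 0 := fun y => by
      have h : y ⊔ 0 - (y ⊔ 0) ⊓ u = (y ⊔ 0 - y ⊔ 0) ⊔ (y ⊔ 0 - u) := sub_inf _ _ _
      rw [sub_self, sub_eq_add_neg (y ⊔ 0) u, sup_add, zero_add, sup_comm 0, sup_assoc,
        sup_eq_right.2 (neg_nonpos.2 hu), ← sub_eq_add_neg] at h
      rw [trunc, ← h]; abel
    rw [Finset.sum_range_succ, ih, step, add_assoc]
    congr 3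
    push_cast
    rw [add_zsmul, one_zsmul]; abel

/-- A subset `S` of the segment `[0, u]` that contains `0` and is closed under `¬x = u - x` and
`x ⊕ y = (x + y) ∧ u`. -/
structure IsSubsegment (u : L) (S : Set L) : Prop where
  zero_mem : 0 ∈ S
  nonneg : ∀ {x}, x ∈ S → 0 ≤ x
  le_unit : ∀ {x}, x ∈ S → x ≤ u
  compl_mem : ∀ {x}, x ∈ S → u - x ∈ S
  oplus_mem : ∀ {x y}, x ∈ S → y ∈ S → (x + y) ⊓ u ∈ S

/-! ### The subgroup generated by a subsegment. -/

namespace IsSubsegment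

variable {u : L} {S : Set L}

theorem unit_mem (hS : IsSubsegment u S) : u ∈ S := by
  have := hS.compl_mem hS.zero_mem
  rwa [sub_zero] at this

theorem unit_nonneg (hS : IsSubsegment u S) : 0 ≤ u := hS.nonneg hS.unit_mem

theorem odot_mem (hS : IsSubsegment u S) {x y : L} (hx : x ∈ S) (hy : y ∈ S) :
    (x + y - u) ⊔ 0 ∈ S := by
  have h := hS.compl_mem (hS.oplus_mem (hS.compl_mem hx) (hS.compl_mem hy))
  rw [sub_inf, sub_self] at h
  convert h using 2; abel

/-- By `trunc_add`, level `n` of `x + s` depends on levels `n` and `n - 1` of `x`; hence the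
hypothesis at all integer levels. -/
theorem trunc_add_mem (hS : IsSubsegment u S) {x s : L} (hs : s ∈ S)
    (hx : ∀ n : ℤ, trunc u (x - n • u) ∈ S) (n : ℤ) : trunc u (x + s - n • u) ∈ S := by
  have e : x + s - n • u = x - n • u + s := by abel
  have e' : x - n • u + u = x - (n - 1) • u := by rw [sub_zsmul, one_zsmul]; abel
  rw [e, trunc_add _ (hS.nonneg hs) (hS.le_unit hs), e']
  exact hS.oplus_mem (hx n) (hS.odot_mem (hx _) hs)

/-- The central lemma. Membership in the generated group is detected inside `S`, by induction on a
word in the elements `±s`, with all levels `n` treated at once. -/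
theorem trunc_mem_of_mem_closure (hS : IsSubsegment u S) {x : L}
    (hx : x ∈ AddSubgroup.closure S) (n : ℤ) : trunc u (x - n • u) ∈ S := by
  induction hx using AddSubgroup.closure_induction_right generalizing n with
  | zero =>
    rw [zero_sub, ← neg_zsmul]
    -- The truncation of a multiple of `u` is `0` or `u`, according to the sign of the coefficient.
    rcases le_or_gt (-n) 0 with h | h
    · rw [trunc_of_nonpos hS.unit_nonneg]
      · exact hS.zero_mem
      · have := zsmul_left_mono hS.unit_nonneg h
        simpa only [zero_zsmul] using this
    · rw [trunc_of_le hS.unit_nonneg]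
      · exact hS.unit_mem
      · have := zsmul_left_mono hS.unit_nonneg (show 1 ≤ -n from h)
        simpa only [one_zsmul] using this
  | add_right x _ s hs ih => exact hS.trunc_add_mem hs ih n
  | add_neg_cancel x _ s hs ih =>
    -- Subtracting `s` is adding its complement `u - s ∈ S` and moving up one level, so the additive
    -- case suffices.
    have e : x + -s - n • u = x + (u - s) - (n + 1) • u := by
      rw [add_zsmul, one_zsmul]; abel
    rw [e]
    exact hS.trunc_add_mem (hS.compl_mem hs) ih _

theorem exists_le_of_mem_closure (hS : IsSubsegment u S) {x : L}
    (hx : x ∈ AddSubgroup.closure S) : ∃ n : ℕ, x ≤ n • u := by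
  induction hx using AddSubgroup.closure_induction_right with
  | zero => exact ⟨0, by rw [zero_nsmul]⟩
  | add_right x _ s hs ih =>
    obtain ⟨n, hn⟩ := ih
    exact ⟨n + 1, by rw [succ_nsmul]; exact add_le_add hn (hS.le_unit hs)⟩
  | add_neg_cancel x _ s hs ih =>
    obtain ⟨n, hn⟩ := ih
    exact ⟨n, (add_le_of_nonpos_right (neg_nonpos.2 (hS.nonneg hs))).trans hn⟩

/-- Here `x` need not lie in the generated group. `mem_closure_segment` uses this for an arbitrary
`x` to show that `[0, u]` generates the whole ring. -/
theorem sup_zero_mem_closure (hS : IsSubsegment u S) {x : L} {n : ℕ} (hn : x ≤ n • u)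
    (hx : ∀ n : ℕ, trunc u (x - (n : ℤ) • u) ∈ S) : x ⊔ 0 ∈ AddSubgroup.closure S := by
  rw [sup_zero_eq_sum_trunc hS.unit_nonneg x n, natCast_zsmul u n,
    sup_eq_right.2 (sub_nonpos.2 hn), add_zero]
  exact sum_mem fun i _ => AddSubgroup.subset_closure (hx i)

theorem sup_mem_closure (hS : IsSubsegment u S) {x y : L} (hx : x ∈ AddSubgroup.closure S)
    (hy : y ∈ AddSubgroup.closure S) : x ⊔ y ∈ AddSubgroup.closure S := by
  have hxy := sub_mem hx hy
  obtain ⟨n, hn⟩ := hS.exists_le_of_mem_closure hxy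
  have := add_mem (hS.sup_zero_mem_closure hn fun k => hS.trunc_mem_of_mem_closure hxy k) hy
  rwa [sup_add, sub_add_cancel, zero_add] at this

theorem inf_mem_closure (hS : IsSubsegment u S) {x y : L} (hx : x ∈ AddSubgroup.closure S)
    (hy : y ∈ AddSubgroup.closure S) : x ⊓ y ∈ AddSubgroup.closure S := by
  have := neg_mem (hS.sup_mem_closure (neg_mem hx) (neg_mem hy))
  rwa [neg_sup, neg_neg, neg_neg] at this

/-- Generating a group adds nothing new inside `[0, u]`, since such an `x` is its own truncation at
level `0`. This gives surjectivity of `A → Γ(A^♯)`. -/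
theorem mem_of_mem_closure (hS : IsSubsegment u S) {x : L} (hx : x ∈ AddSubgroup.closure S)
    (h0 : 0 ≤ x) (hu : x ≤ u) : x ∈ S := by
  have := hS.trunc_mem_of_mem_closure hx 0
  rwa [zero_zsmul, sub_zero, trunc_of_mem h0 hu] at this

end IsSubsegment

end LGroup

/-- By biadditivity, a multiplicatively closed set generates a subring already as an additive group,
so the purely additive results on subsegments apply to rings. -/
theorem mul_mem_addSubgroup_closure {R : Type*} [NonUnitalCommRing R] {S : Set R}
    (hS : ∀ x ∈ S, ∀ y ∈ S, x * y ∈ S) {x y : R} (hx : x ∈ AddSubgroup.closure S)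
    (hy : y ∈ AddSubgroup.closure S) : x * y ∈ AddSubgroup.closure S := by
  induction hx using AddSubgroup.closure_induction with
  | mem x hx =>
    induction hy using AddSubgroup.closure_induction with
    | mem y hy => exact AddSubgroup.subset_closure (hS x hx y hy)
    | zero => rw [mul_zero]; exact zero_mem _
    | add a b _ _ ha hb => rw [mul_add]; exact add_mem ha hb
    | neg a _ ha => rw [mul_neg]; exact neg_mem ha
  | zero => rw [zero_mul]; exact zero_mem _
  | add a b _ _ ha hb => rw [add_mul]; exact add_mem ha hb
  | neg a _ ha => rw [neg_mul]; exact neg_mem ha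

/-! ### Prime ideals separate points -/

section Prime

variable {A : Type*} [MVAlgebra A]

/-- Residuation twice: remove `y` from the left side to land below `x ∧ z`, then remove `x ∧ z` to
land below `y ∧ z`. It makes `MVIdeal.residual` closed under `⊕`. -/
theorem inf_oplus_le (x y z : A) : (x ⊕ₘ y) ⊓ z ≤ (x ⊓ z) ⊕ₘ (y ⊓ z) := by
  have h : ((x ⊕ₘ y) ⊓ z) ⊖ₘ y ≤ x ⊓ z :=
    le_inf (ominus_le_iff.2 (by rw [oplus_comm]; exact inf_le_left))
      ((ominus_le_self _ _).trans inf_le_right)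
  rw [← ominus_le_iff]
  refine le_inf (ominus_le_iff.2 ?_) ((ominus_le_self _ _).trans inf_le_right)
  rw [oplus_comm (x ⊓ z)]
  exact ominus_le_iff.1 h

/-- The ideal `{x : x ∧ a ∈ I}`. -/
def MVIdeal.residual (I : MVIdeal A) (a : A) : MVIdeal A where
  carrier := {x | x ⊓ a ∈ I.carrier}
  nonempty' := ⟨0, I.mem_of_le inf_le_left I.zero_mem⟩
  mem_of_le h hb := I.mem_of_le (inf_le_inf_right a h) hb
  oplus_mem hx hy := I.mem_of_le (inf_oplus_le _ _ a) (I.oplus_mem hx hy)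

theorem MVIdeal.mem_residual_of_mem (I : MVIdeal A) (a : A) {x : A} (hx : x ∈ I.carrier) :
    x ∈ (I.residual a).carrier := I.mem_of_le inf_le_left hx

theorem exists_maximal_ideal_notMem {c : A} (hc : c ≠ 0) :
    ∃ M : MVIdeal A, c ∉ M.carrier ∧
      ∀ I : MVIdeal A, M.carrier ⊆ I.carrier → c ∉ I.carrier → I.carrier ⊆ M.carrier := by
  obtain ⟨m, -, hm⟩ := zorn_subset_nonempty {s | ∃ I : MVIdeal A, I.carrier = s ∧ c ∉ s}
    (by
      intro C hC hchain hne
      obtain ⟨s₀, hs₀⟩ := hne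
      obtain ⟨I₀, rfl, -⟩ := hC hs₀
      refine ⟨⋃₀ C, ⟨⟨⋃₀ C, ⟨0, _, hs₀, I₀.zero_mem⟩, ?_, ?_⟩, rfl, ?_⟩,
        fun s hs => Set.subset_sUnion_of_mem hs⟩
      · rintro a b h ⟨s, hs, hb⟩
        obtain ⟨I, rfl, -⟩ := hC hs
        exact ⟨_, hs, I.mem_of_le h hb⟩
      · rintro a b ⟨s, hs, ha⟩ ⟨t, ht, hb⟩
        obtain ⟨I, rfl, -⟩ := hC hs
        obtain ⟨J, rfl, -⟩ := hC ht
        rcases hchain.total hs ht with h | h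
        · exact ⟨_, ht, J.oplus_mem (h ha) hb⟩
        · exact ⟨_, hs, I.oplus_mem ha (h hb)⟩
      · rintro ⟨s, hs, hcs⟩
        obtain ⟨I, rfl, hI⟩ := hC hs
        exact hI hcs)
    -- Zorn's lemma starts from the zero ideal, which omits `c` because `c ≠ 0`.
    {0} ⟨⟨{0}, ⟨0, rfl⟩, fun {a b} h hb => by
      rw [Set.mem_singleton_iff] at *; subst hb; exact le_zero_iff'.1 h, fun {a b} ha hb => by
      rw [Set.mem_singleton_iff] at *; rw [ha, hb, oplus_zero]⟩, rfl, hc⟩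
  obtain ⟨M, rfl, hM⟩ := hm.prop
  exact ⟨M, hM, fun I hI hcI => hm.le_of_ge ⟨I, rfl, hcI⟩ hI⟩

/-- An ideal `M` maximal among those omitting `c` is prime. If `a ∧ b ∈ M` with `a, b ∉ M`, then `{x
: x ∧ a ∈ M}` contains `M` and `b`, so by maximality it contains `c`. Now `{x : x ∧ c ∈ M}` contains
`M` and `a`, so it too contains `c`, whence `c = c ∧ c ∈ M`. -/
theorem exists_spec_notMem {c : A} (hc : c ≠ 0) : ∃ P : Spec A, c ∉ P.1.carrier := by
  obtain ⟨M, hM, hmax⟩ := exists_maximal_ideal_notMem hc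
  refine ⟨⟨M, fun a b hab => ?_⟩, hM⟩
  by_contra! h
  have hca : c ∈ (M.residual a).carrier := by
    by_contra hca
    refine h.2 (hmax _ (fun x => M.mem_residual_of_mem a) hca ?_)
    change b ⊓ a ∈ M.carrier
    rwa [inf_comm]
  have hcc : c ∈ (M.residual c).carrier := by
    by_contra hcc
    refine h.1 (hmax _ (fun x => M.mem_residual_of_mem c) hcc ?_)
    change a ⊓ c ∈ M.carrier
    rwa [inf_comm]
  exact hM (by simpa [MVIdeal.residual] using hcc)

theorem eq_of_cls_eq {a b : A} (h : ∀ P : Spec A, P.1.cls a = P.1.cls b) : a = b := by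
  have key : ∀ x y : A, (∀ P : Spec A, x ⊖ₘ y ∈ P.1.carrier) → x ≤ y := fun x y hxy => by
    by_contra hle
    obtain ⟨P, hP⟩ := exists_spec_notMem (c := x ⊖ₘ y) hle
    exact hP (hxy P)
  exact le_antisymm (key a b fun P => (P.1.cls_eq.1 (h P)).1)
    (key b a fun P => (P.1.cls_eq.1 (h P)).2)

end Prime

/-! ### The isomorphism `A ≅ Γ(A^♯)` -/

section Unit

/-- The degenerate case `0 = u` does occur, since the improper ideal belongs to `Spec`; then `A` has
one element. Otherwise `Chang.norm` separates the classes. -/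
theorem Chang.inj_injective {A : Type*} [MVAlgebra A] :
    Function.Injective (Chang.inj : A → Chang A) := by
  intro a b h
  by_cases h0 : (0 : A) = mtop A
  · exact (le_antisymm (h0 ▸ le_mtop a) (zero_le' a)).trans
      (le_antisymm (h0 ▸ le_mtop b) (zero_le' b)).symm
  · have e := congrArg (Chang.norm h0) h
    unfold Chang.inj at e
    rw [Chang.norm_pair, Chang.norm_pair] at e
    split_ifs at e with h1 h2 h2
    · rw [h1, h2]
    · exact absurd (congrArg Prod.fst e) (by norm_num)
    · exact absurd (congrArg Prod.fst e) (by norm_num)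
    · exact congrArg Prod.snd e

/-- In a chain, either `a ⊙ b = 0` and the sum is not cut off, or `a ⊕ b = u` and the sum `(1, a ⊙
b)` lies above `(0, u)`. -/
theorem Chang.inj_oplus_eq_inf {A : Type*} [MVAlgebra A] [MVChain A] (a b : A) :
    Chang.inj (a ⊕ₘ b) = (Chang.inj a + Chang.inj b) ⊓ Chang.inj (mtop A) := by
  rcases Chang.odot_or a b with h | h
  · rw [← Chang.inj_oplus h, inf_eq_left.2 (Chang.inj_mono (le_mtop _))]
  · rw [h, eq_comm, inf_eq_right]
    unfold Chang.inj
    rw [Chang.pair_add_of_eq _ _ h]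
    exact ⟨_, _, _, _, rfl, rfl, Or.inl (by norm_num)⟩

theorem Chang.inj_mneg {A : Type*} [MVAlgebra A] [MVChain A] (a : A) :
    Chang.inj (¬ₘa) = Chang.inj (mtop A) - Chang.inj a := by
  rw [← oplus_mneg a, Chang.inj_oplus (odot_mneg a)]; abel

variable {A B : Type*} [PMVfAlgebra A] [PMVfAlgebra B]

theorem hat_injective : Function.Injective (hat : A → SharpProd A) := fun _ _ h =>
  eq_of_cls_eq fun P => Chang.inj_injective (congrFun h P)

theorem hat_oplus (a b : A) : hat (a ⊕ₘ b) = (hat a + hat b) ⊓ hat (mtop A) :=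
  funext fun P => Chang.inj_oplus_eq_inf (P.1.cls a) (P.1.cls b)

theorem hat_mneg (a : A) : hat (¬ₘa) = hat (mtop A) - hat a :=
  funext fun P => Chang.inj_mneg (P.1.cls a)

theorem hat_mul (a b : A) : hat (a * b) = hat a * hat b :=
  funext fun P => (Chang.inj_mul (P.1.cls a) (P.1.cls b)).symm

theorem isSubsegment_range_hat : IsSubsegment (hat (mtop A)) (Set.range (hat : A → SharpProd A)) where
  zero_mem := ⟨0, rfl⟩
  nonneg := by rintro _ ⟨a, rfl⟩; exact hat_nonneg a
  le_unit := by rintro _ ⟨a, rfl⟩; exact hat_le a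
  compl_mem := by rintro _ ⟨a, rfl⟩; exact ⟨¬ₘa, hat_mneg a⟩
  oplus_mem := by rintro _ _ ⟨a, rfl⟩ ⟨b, rfl⟩; exact ⟨a ⊕ₘ b, hat_oplus a b⟩

/-- As an additive group, `A^♯` is generated by the elements `(0, â)`. -/
theorem mem_closure_range_hat {x : SharpProd A} (hx : x ∈ sharpSubring A) :
    x ∈ AddSubgroup.closure (Set.range (hat : A → SharpProd A)) := by
  have hmul : ∀ x ∈ Set.range (hat : A → SharpProd A), ∀ y ∈ Set.range (hat : A → SharpProd A),
      x * y ∈ Set.range (hat : A → SharpProd A) := by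
    rintro _ ⟨a, rfl⟩ _ ⟨b, rfl⟩
    exact ⟨a * b, hat_mul a b⟩
  -- The generated group is itself an `l`-subring containing every `hat a`, so it contains the
  -- smallest one.
  refine mem_sharpSubring.1 hx
    { AddSubgroup.closure (Set.range (hat : A → SharpProd A)) with
      mul_mem' := mul_mem_addSubgroup_closure hmul }
    ⟨fun a => AddSubgroup.subset_closure ⟨a, rfl⟩, fun x hx y hy => ⟨?_, ?_⟩⟩
  · exact isSubsegment_range_hat.sup_mem_closure hx hy
  · exact isSubsegment_range_hat.inf_mem_closure hx hy

/-- The homomorphism `A → Γ(A^♯)`, `a ↦ (0, â)`. -/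
noncomputable def unitHom (A : Type*) [PMVfAlgebra A] : PMVfHom A (Segment (Sharp A)) where
  toFun a := ⟨Sharp.of a, hat_nonneg a, hat_le a⟩
  map_zero' := rfl
  map_oplus' a b := Subtype.ext (Subtype.ext (hat_oplus a b))
  map_mneg' a := Subtype.ext (Subtype.ext (hat_mneg a))
  map_mul' a b := Subtype.ext (Subtype.ext (hat_mul a b))

/-- Injectivity is the separation of points by prime ideals; surjectivity is the subsegment theorem
for the range of `hat`. -/
theorem unitHom_bijective : Function.Bijective (unitHom A) := by
  constructor
  · intro a b h
    exact hat_injective (congrArg (fun x : Segment (Sharp A) => x.1.1) h)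
  · rintro ⟨⟨x, hx⟩, h0, hu⟩
    obtain ⟨a, ha⟩ := isSubsegment_range_hat.mem_of_mem_closure (mem_closure_range_hat hx) h0 hu
    exact ⟨a, Subtype.ext (Subtype.ext ha)⟩

/-- The inverse of a bijective homomorphism. -/
noncomputable def PMVfHom.inverse (f : PMVfHom A B) (hf : Function.Bijective f) : PMVfHom B A where
  toFun := (Equiv.ofBijective f hf).symm
  map_zero' := by
    rw [Equiv.symm_apply_eq]; exact f.map_zero.symm
  map_oplus' x y := by
    rw [Equiv.symm_apply_eq]
    change _ = f _
    rw [f.map_oplus]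
    exact (congrArg₂ _ (Equiv.ofBijective_apply_symm_apply f hf x)
      (Equiv.ofBijective_apply_symm_apply f hf y)).symm
  map_mneg' x := by
    rw [Equiv.symm_apply_eq]
    change _ = f _
    rw [f.map_mneg]
    exact (congrArg _ (Equiv.ofBijective_apply_symm_apply f hf x)).symm
  map_mul' x y := by
    rw [Equiv.symm_apply_eq]
    change _ = f _
    rw [f.map_mul]
    exact (congrArg₂ _ (Equiv.ofBijective_apply_symm_apply f hf x)
      (Equiv.ofBijective_apply_symm_apply f hf y)).symm

end Unit

/-! ### `Γ` is fully faithful -/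

section Extension

open SemiLowRing

variable {R S : Type*} [SemiLowRing R] [SemiLowRing S]

/-- Every element of a semi-low `l_u`-ring is a sum of elements `±x` with `x ∈ [0, u]`. -/
theorem mem_closure_segment (x : R) :
    x ∈ AddSubgroup.closure {x : R | 0 ≤ x ∧ x ≤ u} := by
  have hS : IsSubsegment (u : R) {x : R | 0 ≤ x ∧ x ≤ u} :=
    { zero_mem := ⟨le_refl _, u_nonneg⟩
      nonneg := fun h => h.1
      le_unit := fun h => h.2
      compl_mem := fun h => ⟨sub_nonneg.2 h.2, sub_le_self _ h.1⟩
      oplus_mem := fun h h' => ⟨le_inf (add_nonneg h.1 h'.1) u_nonneg, inf_le_right⟩ }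
  have key : ∀ y : R, y ⊔ 0 ∈ AddSubgroup.closure {x : R | 0 ≤ x ∧ x ≤ u} := fun y => by
    obtain ⟨n, hn⟩ := u_strong y
    -- For the full segment, truncations belong to it by construction; the strong unit makes their
    -- number finite.
    exact hS.sup_zero_mem_closure ((le_abs_self y).trans hn)
      fun k => ⟨le_inf le_sup_right u_nonneg, inf_le_right⟩
  have := sub_mem (key x) (key (-x))
  rwa [show x ⊔ 0 - (-x ⊔ 0) = x from posPart_sub_negPart x] at this

/-- The graph of a map of segments, as a subset of `R × S`. -/
def segmentGraph (h : PMVfHom (Segment R) (Segment S)) : Set (R × S) :=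
  Set.range fun x : Segment R => (x.1, (h x).1)

/-- That `h` respects the MV-operations is exactly what makes its graph a subsegment of the
`l`-group `R × S`. The group it generates is then a sublattice, and will be the graph of the
extension of `h`. -/
theorem isSubsegment_segmentGraph (h : PMVfHom (Segment R) (Segment S)) :
    IsSubsegment ((u, u) : R × S) (segmentGraph h) where
  zero_mem := ⟨0, congrArg (fun z : Segment S => ((0 : R), z.1)) h.map_zero⟩
  nonneg := by rintro _ ⟨x, rfl⟩; exact ⟨x.2.1, (h x).2.1⟩
  le_unit := by rintro _ ⟨x, rfl⟩; exact ⟨x.2.2, (h x).2.2⟩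
  compl_mem := by
    rintro _ ⟨x, rfl⟩
    exact ⟨¬ₘx, congrArg (fun z : Segment S => (u - x.1, z.1)) (h.map_mneg x)⟩
  oplus_mem := by
    rintro _ _ ⟨x, rfl⟩ ⟨y, rfl⟩
    exact ⟨x ⊕ₘ y, congrArg (fun z : Segment S => ((x.1 + y.1) ⊓ u, z.1)) (h.map_oplus x y)⟩

theorem mul_mem_closure_segmentGraph (h : PMVfHom (Segment R) (Segment S)) {x y : R × S}
    (hx : x ∈ AddSubgroup.closure (segmentGraph h))
    (hy : y ∈ AddSubgroup.closure (segmentGraph h)) :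
    x * y ∈ AddSubgroup.closure (segmentGraph h) := by
  refine mul_mem_addSubgroup_closure ?_ hx hy
  rintro _ ⟨x, rfl⟩ _ ⟨y, rfl⟩
  exact ⟨x * y, congrArg (fun z : Segment S => (x.1 * y.1, z.1)) (h.map_mul x y)⟩

/-- The kernel of single-valuedness. The truncations of `(0, y)` lie on the graph of `h`; for `n ≥
0` their first coordinate is `0`, so the second is `h 0 = 0`. The positive part of `y` is a sum of
such second coordinates. -/
theorem snd_nonpos_of_mem_closure_segmentGraph (h : PMVfHom (Segment R) (Segment S)) {y : S}
    (hy : ((0 : R), y) ∈ AddSubgroup.closure (segmentGraph h)) : y ≤ 0 := by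
  have ht : ∀ n : ℕ, trunc u (y - (n : ℤ) • u) = 0 := fun n => by
    obtain ⟨x, hx⟩ := (isSubsegment_segmentGraph h).trunc_mem_of_mem_closure hy n
    have h1 : x.1 = trunc u (0 - (n : ℤ) • u) := congrArg Prod.fst hx
    have h2 : (h x).1 = trunc u (y - (n : ℤ) • u) := congrArg Prod.snd hx
    rw [trunc_of_nonpos u_nonneg (by
      rw [zero_sub, natCast_zsmul]; exact neg_nonpos.2 (nsmul_nonneg u_nonneg n))] at h1
    have h3 : x = 0 := Subtype.ext h1
    rw [← h2, h3, h.map_zero]; rfl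
  obtain ⟨n, hn⟩ := u_strong y
  have e := sup_zero_eq_sum_trunc u_nonneg y n
  rw [Finset.sum_eq_zero fun i _ => ht i, zero_add, natCast_zsmul,
    sup_eq_right.2 (sub_nonpos.2 ((le_abs_self y).trans hn))] at e
  exact sup_eq_right.1 e

/-- Both differences `(0, y - y')` and `(0, y' - y)` lie in the group, so each has a nonpositive
second coordinate. -/
theorem closure_segmentGraph_unique (h : PMVfHom (Segment R) (Segment S)) {x : R} {y y' : S}
    (hy : (x, y) ∈ AddSubgroup.closure (segmentGraph h))
    (hy' : (x, y') ∈ AddSubgroup.closure (segmentGraph h)) : y = y' := by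
  have key : ∀ {y y' : S}, (x, y) ∈ AddSubgroup.closure (segmentGraph h) →
      (x, y') ∈ AddSubgroup.closure (segmentGraph h) → y ≤ y' := fun {y y'} hy hy' => by
    have := sub_mem hy hy'
    rw [Prod.mk_sub_mk, sub_self] at this
    exact sub_nonpos.1 (snd_nonpos_of_mem_closure_segmentGraph h this)
  exact le_antisymm (key hy hy') (key hy' hy)

theorem exists_mem_closure_segmentGraph (h : PMVfHom (Segment R) (Segment S)) (x : R) :
    ∃ y : S, (x, y) ∈ AddSubgroup.closure (segmentGraph h) := by
  induction mem_closure_segment x using AddSubgroup.closure_induction with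
  | mem x hx => exact ⟨_, AddSubgroup.subset_closure ⟨⟨x, hx⟩, rfl⟩⟩
  | zero => exact ⟨0, zero_mem _⟩
  | add a b _ _ ha hb =>
    obtain ⟨y, hy⟩ := ha
    obtain ⟨z, hz⟩ := hb
    exact ⟨y + z, add_mem hy hz⟩
  | neg a _ ha =>
    obtain ⟨y, hy⟩ := ha
    exact ⟨-y, neg_mem hy⟩

/-- The extension of a homomorphism `[0, u] → [0, u]` of `PMV_f`-algebras to `R → S`. -/
noncomputable def extend (h : PMVfHom (Segment R) (Segment S)) : LuHom R S :=
  have spec : ∀ x, (x, (exists_mem_closure_segmentGraph h x).choose) ∈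
      AddSubgroup.closure (segmentGraph h) :=
    fun x => (exists_mem_closure_segmentGraph h x).choose_spec
  { toFun := fun x => (exists_mem_closure_segmentGraph h x).choose
    -- Each law holds by uniqueness: the chosen value and the value computed from the arguments both
    -- pair with the same first coordinate in the generated sub-`l`-ring.
    map_add' := fun x y =>
      closure_segmentGraph_unique h (spec _) (add_mem (spec x) (spec y))
    map_mul' := fun x y =>
      closure_segmentGraph_unique h (spec _) (mul_mem_closure_segmentGraph h (spec x) (spec y))
    map_sup' := fun x y => closure_segmentGraph_unique h (spec _)
      ((isSubsegment_segmentGraph h).sup_mem_closure (spec x) (spec y))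
    map_inf' := fun x y => closure_segmentGraph_unique h (spec _)
      ((isSubsegment_segmentGraph h).inf_mem_closure (spec x) (spec y))
    map_u' := closure_segmentGraph_unique h (spec _)
      (AddSubgroup.subset_closure (isSubsegment_segmentGraph h).unit_mem) }

theorem extend_val (h : PMVfHom (Segment R) (Segment S)) (x : Segment R) :
    extend h x.1 = (h x).1 :=
  closure_segmentGraph_unique h (exists_mem_closure_segmentGraph h x.1).choose_spec
    (AddSubgroup.subset_closure ⟨x, rfl⟩)

/-- Faithfulness of `Γ`: additive maps are determined on a generating set of the group. -/
theorem LuHom.ext_segment {f g : LuHom R S} (h : ∀ x : Segment R, f x.1 = g x.1) : f = g := by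
  apply LuHom.ext
  funext x
  change f x = g x
  induction mem_closure_segment x using AddSubgroup.closure_induction with
  | mem x hx => exact h ⟨x, hx⟩
  | zero => rw [f.map_zero, g.map_zero]
  | add a b _ _ ha hb => rw [f.map_add, g.map_add, ha, hb]
  | neg a _ ha => rw [← zero_sub, f.map_sub, g.map_sub, ha, f.map_zero, g.map_zero]

end Extension

/-! ### The equivalence -/

/-- `Γ` is fully faithful. -/
noncomputable def gammaFullyFaithful : Gamma.{v}.FullyFaithful where
  preimage {R S} h := extend (R := R) (S := S) h
  map_preimage {R S} h := PMVfHom.ext (funext fun x => Subtype.ext (extend_val (R := R) (S := S) h x))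
  preimage_map f := LuHom.ext_segment fun x => extend_val (Segment.map f) x

/-- The isomorphism `A ≅ Γ(A^♯)`. -/
noncomputable def unitIsoApp (A : PMVfCat.{v}) : A ≅ Gamma.obj (sharp.obj A) where
  hom := unitHom A
  inv := (unitHom A).inverse unitHom_bijective
  hom_inv_id := PMVfHom.ext (funext fun a =>
    Equiv.ofBijective_symm_apply_apply (unitHom A) unitHom_bijective a)
  inv_hom_id := PMVfHom.ext (funext fun a =>
    Equiv.ofBijective_apply_symm_apply (unitHom A) unitHom_bijective a)

/-- The natural isomorphism `A ≅ Γ(A^♯)`, `a ↦ (0, â)`. -/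
noncomputable def unitNatIso : 𝟭 PMVfCat.{v} ≅ sharp ⋙ Gamma :=
  NatIso.ofComponents unitIsoApp fun _ => rfl

/-- The natural isomorphism `Γ(R)^♯ ≅ R`, whose image under `Γ` is inverse to
`x ↦ (0, x̂)`. -/
noncomputable def counitNatIso : Gamma ⋙ sharp ≅ 𝟭 LRuCat.{v} :=
  NatIso.ofComponents (fun R => gammaFullyFaithful.preimageIso (unitIsoApp (Gamma.obj R)).symm)
    fun {R S} f => gammaFullyFaithful.map_injective (by
      -- As `Γ` is faithful, naturality may be checked after applying it, where it becomes
      -- naturality of the inverse of `A ≅ Γ(A^♯)` at the morphism `Γ(f)`.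
      have h := unitNatIso.inv.naturality (Gamma.map f)
      simp only [Functor.map_comp, Functor.FullyFaithful.preimageIso_hom,
        Functor.FullyFaithful.map_preimage]
      exact h)

/-- This is a triangle identity read on elements: `x ↦ (0, x̂)` followed by `Γ(τ_R)` is the identity
of `[0, u]`. -/
theorem counitNatIso_of (R : LRuCat.{v}) (x : Segment R) :
    counitNatIso.hom.app R (Sharp.of x) = x.val := by
  have h : (unitIsoApp (Gamma.obj R)).hom ≫ Gamma.map (counitNatIso.hom.app R) = 𝟙 _ := by
    have e : Gamma.map (counitNatIso.hom.app R) = (unitIsoApp (Gamma.obj R)).inv :=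
      gammaFullyFaithful.map_preimage _
    rw [e, Iso.hom_inv_id]
  exact congrArg (fun f : PMVfHom (Segment R) (Segment R) => (f x).1) h

end PMV

theorem mainTheorem1 :
    ∃ (η : 𝟭 PMV.PMVfCat.{v} ≅ PMV.sharp ⋙ PMV.Gamma)
      (τ : PMV.Gamma ⋙ PMV.sharp ≅ 𝟭 PMV.LRuCat.{v}),
      (∀ (A : PMV.PMVfCat.{v}) (a : A), (η.hom.app A a).val = PMV.Sharp.of a) ∧
      (∀ (R : PMV.LRuCat.{v}) (x : PMV.Segment R), τ.hom.app R (PMV.Sharp.of x) = x.val) ∧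
      (∃ e : PMV.PMVfCat.{v} ≌ PMV.LRuCat.{v},
        e.functor = PMV.sharp ∧ e.inverse = PMV.Gamma) :=
  ⟨PMV.unitNatIso, PMV.counitNatIso, fun _ _ => rfl, PMV.counitNatIso_of,
    -- No triangle identity has to be supplied, since `Equivalence.mk` adjusts the unit to make one
    -- hold; the two functors are left unchanged.
    CategoryTheory.Equivalence.mk PMV.sharp PMV.Gamma PMV.unitNatIso PMV.counitNatIso, rfl, rfl⟩
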